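/- Let $\mathfrak o$ be a Dedekind domain which is not a field, $K$ its fraction field, $L/K$ an algebraic extension of fields (possibly infinite), and $\mathfrak O$ the integral closure of $\mathfrak o$ in $L$. A fractional ideal of $\mathfrak O$ is a non-zero $\mathfrak O$-submodule $I\subseteq L$ with $dI\subseteq\mathfrak O$ for some $d\in L^\times$; under multiplication of ideals these form an abelian monoid $\mathcal F(\mathfrak O)$ with identity $\mathfrak O$. Call $I\in\mathcal F(\mathfrak O)$ invertible if $IJ=\mathfrak O$ for some $J\in\mathcal F(\mathfrak O)$, and regular if $I=IJI$ for some $J\in\mathcal F(\mathfrak O)$. Let $X=\mathrm{m\text{-}Spec}\,\mathfrak O$ be the set of maximal ideals of $\mathfrak O$ with the topology whose open base consists of the sets $\mathcal U(A)=\{\mathfrak P\in X: A\subseteq\mathfrak P\}$ for $A\subseteq\mathfrak O$ finite (the Krull-like topology). Let $\widetilde{\mathbb R}=\mathbb R\times\{0,1\}$, with the lexicographic order, the addition $(\alpha,s)+(\beta,t)=(\alpha+\beta,\max\{s,t\})$ and the involution $\iota(\alpha,s)=(-\alpha,s)$. A function $f\colon X\to\widetilde{\mathbb R}$ is upper $\widetilde{\mathbb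 R}$-semicontinuous if $\{x\in X: f(x)<a\}$ is open for every $a\in\widetilde{\mathbb R}$; it is bounded if $a\le f(x)\le b$ for all $x\in X$, for some $a,b\in\widetilde{\mathbb R}$; it is compactly supported if $f=(0,0)$ outside some compact subset of $X$. Let $\mathcal S^u_{0,b}(X;\widetilde{\mathbb R})$ be the monoid, under pointwise addition, of all upper $\widetilde{\mathbb R}$-semicontinuous, bounded, compactly supported functions $X\to\widetilde{\mathbb R}$, and let $\mathcal S^u_{0,\mathrm{ref}}(X;\widetilde{\mathbb R})$ be the submonoid of the reflexible functions, i.e. those $f$ such that both $f$ and $\iota\circ f$ lie in $\mathcal S^u_{0,b}(X;\widetilde{\mathbb R})$. For $\mathfrak P\in X$ let $v_{\mathfrak P}\colon L^\times\to\mathbb Q$ be the additive valuation with valuation ring $\mathfrak O_{\mathfrak P}$, normalized by $v_{\mathfrak P}(K^\times)=\mathbb Z$ (it exists and is unique), and put $v_{\mathfrak P}(0)=+\infty$. Let $V_{\mathfrak P}$ be the closure of $v_{\mathfrak P}(L^\times)$ in $\mathbb R$. Put $\mathrm{val}_{\mathfrak P}=\{(\alpha,0):\alpha\in v_{\mathfrak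 P}(L^\times)\}$, and let $\widetilde V_{\mathfrak P}=\mathrm{val}_{\mathfrak P}\sqcup\{(\beta,1):\beta\in\mathbb R\}$ if $V_{\mathfrak P}=\mathbb R$, and $\widetilde V_{\mathfrak P}=\mathrm{val}_{\mathfrak P}$ otherwise (i.e. if $V_{\mathfrak P}=v_{\mathfrak P}(L^\times)$). Let $$\mathcal S^u_{0,b}(\mathfrak O;\widetilde V)=\{f\in\mathcal S^u_{0,b}(X;\widetilde{\mathbb R}): f(\mathfrak P)\in\widetilde V_{\mathfrak P}\text{ for all }\mathfrak P\in X\},$$ $$\mathcal S^u_{0,\mathrm{ref}}(\mathfrak O;\widetilde V)=\{f\in\mathcal S^u_{0,\mathrm{ref}}(X;\widetilde{\mathbb R}): f(\mathfrak P)\in\widetilde V_{\mathfrak P}\text{ for all }\mathfrak P\in X\},$$ $$\mathcal S^u_{0,\mathrm{ref}}(\mathfrak O;\mathrm{val})=\{f\in\mathcal S^u_{0,\mathrm{ref}}(X;\widetilde{\mathbb R}): f(\mathfrak P)\in\mathrm{val}_{\mathfrak P}\text{ for all }\mathfrak P\in X\}.$$ For $I\in\mathcal F(\mathfrak O)$ define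 $\tilde f_I\colon X\to\widetilde{\mathbb R}$ by $\tilde f_I(\mathfrak P)=(\inf_{x\in I}v_{\mathfrak P}(x),\,s)$, where $s=0$ if the infimum is attained by some $x\in I$, and $s=1$ otherwise. Theorem. (i) $I\mapsto\tilde f_I$ is an isomorphism of monoids $\widetilde F\colon\mathcal F(\mathfrak O)\xrightarrow{\ \simeq\ }\mathcal S^u_{0,b}(\mathfrak O;\widetilde V)$. (ii) The image under $\widetilde F$ of the set of regular elements of $\mathcal F(\mathfrak O)$ is $\mathcal S^u_{0,\mathrm{ref}}(\mathfrak O;\widetilde V)$. (iii) The image under $\widetilde F$ of the set of invertible fractional ideals is $\mathcal S^u_{0,\mathrm{ref}}(\mathfrak O;\mathrm{val})$. -/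

import Mathlib

/-! ### The valuation attached to a maximal ideal of the integral closure -/

/-- A valuation whose values are torsion modulo the powers of `g < 1` is equivalent to an additive
valuation with rational values that takes the value `n` where `v` takes the value `g ^ n`. -/
theorem exists_addValuation {L Γ : Type*} [Field L] [LinearOrderedCommGroupWithZero Γ]
    (v : Valuation L Γ) (g : Γ) (hg0 : 0 < g) (hg1 : g < 1)
    (h : ∀ x : L, x ≠ 0 → ∃ N : ℕ, 0 < N ∧ ∃ n : ℤ, v x ^ N = g ^ n) :
    ∃ w : AddValuation L (WithTop ℚ), (∀ x : L, 0 ≤ w x ↔ v x ≤ 1) ∧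
      ∀ (x : L) (n : ℤ), v x = g ^ n → w x = ((n : ℚ) : WithTop ℚ) := by
  classical
  choose! N hN n hn using h
  have hgz : g ≠ 0 := hg0.ne'
  have cmp : ∀ x y : L, x ≠ 0 → y ≠ 0 →
      (v x ≤ v y ↔ (n y : ℚ) / N y ≤ (n x : ℚ) / N x) := by
    intro x y hx hy
    have hNx := hN x hx
    have hNy := hN y hy
    have e1 : v x ^ (N x * N y) = g ^ (n x * N y) := by
      rw [pow_mul, hn x hx, zpow_mul, zpow_natCast]
    have e2 : v y ^ (N x * N y) = g ^ (n y * N x) := by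
      rw [mul_comm, pow_mul, hn y hy, zpow_mul, zpow_natCast]
    have hne : N x * N y ≠ 0 := (Nat.mul_pos hNx hNy).ne'
    rw [← pow_le_pow_iff_left₀ zero_le zero_le hne, e1, e2,
      zpow_le_zpow_iff_right_of_lt_one₀ hg0 hg1, div_le_div_iff₀ (by exact_mod_cast hNy)
      (by exact_mod_cast hNx)]
    exact_mod_cast Iff.rfl
  have val : ∀ x : L, x ≠ 0 → ∀ M : ℕ, 0 < M → ∀ m : ℤ, v x ^ M = g ^ m →
      (n x : ℚ) / N x = m / M := by
    intro x hx M hM m hm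
    have hNx := hN x hx
    have e1 : v x ^ (N x * M) = g ^ (n x * M) := by
      rw [pow_mul, hn x hx, zpow_mul, zpow_natCast]
    have e2 : v x ^ (N x * M) = g ^ (m * N x) := by
      rw [mul_comm, pow_mul, hm, zpow_mul, zpow_natCast]
    have := zpow_right_injective₀ hg0 hg1.ne (e1.symm.trans e2)
    rw [div_eq_div_iff (by exact_mod_cast hNx.ne') (by exact_mod_cast hM.ne')]
    exact_mod_cast this
  have one : (n 1 : ℚ) / N 1 = 0 := by
    rw [val 1 one_ne_zero 1 one_pos 0 (by simp)]; simp
  let f : L → WithTop ℚ := fun x => if x = 0 then ⊤ else ((n x / N x : ℚ) : WithTop ℚ)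
  have f0 : f 0 = ⊤ := if_pos rfl
  have fx : ∀ x, x ≠ 0 → f x = ((n x / N x : ℚ) : WithTop ℚ) := fun x hx => if_neg hx
  have f1 : f 1 = 0 := by rw [fx 1 one_ne_zero, one]; rfl
  have fcmp : ∀ x y, v x ≤ v y ↔ f y ≤ f x := by
    intro x y
    by_cases hx : x = 0
    · subst hx; simp [f0]
    by_cases hy : y = 0
    · subst hy; simp [f0, fx x hx, hx]
    rw [fx x hx, fx y hy, WithTop.coe_le_coe]
    exact cmp x y hx hy
  refine ⟨AddValuation.of f f0 f1 ?_ ?_, ?_, ?_⟩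
  · intro x y
    rcases le_total (v x) (v y) with hxy | hxy
    · exact (min_le_right _ _).trans ((fcmp _ _).1 ((v.map_add x y).trans (max_le hxy le_rfl)))
    · exact (min_le_left _ _).trans ((fcmp _ _).1 ((v.map_add x y).trans (max_le le_rfl hxy)))
  · intro x y
    by_cases hx : x = 0
    · subst hx; simp [f0]
    by_cases hy : y = 0
    · subst hy; simp [f0]
    have hNx := hN x hx
    have hNy := hN y hy
    rw [fx x hx, fx y hy, fx _ (mul_ne_zero hx hy), ← WithTop.coe_add, WithTop.coe_inj,
      val (x * y) (mul_ne_zero hx hy) (N x * N y) (Nat.mul_pos hNx hNy) (n x * N y + n y * N x)]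
    · push_cast
      field_simp
    · rw [map_mul, mul_pow, zpow_add₀ hgz]
      congr 1
      · rw [pow_mul, hn x hx, zpow_mul, zpow_natCast]
      · rw [mul_comm (N x), pow_mul, hn y hy, zpow_mul, zpow_natCast]
  · intro x
    rw [AddValuation.of_apply, ← f1, ← fcmp, map_one]
  · intro x m hm
    have hx : x ≠ 0 := by
      rintro rfl
      rw [map_zero] at hm
      exact zpow_ne_zero m hgz hm.symm
    rw [AddValuation.of_apply, fx x hx, val x hx 1 one_pos m (by simpa using hm)]
    simp

/-- In a valued field algebraic over `K`, values are torsion modulo the values of `K`. -/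
theorem exists_pow_val_eq {K L Γ : Type*} [Field K] [Field L] [Algebra K L]
    [Algebra.IsAlgebraic K L] [LinearOrderedCommGroupWithZero Γ] (v : Valuation L Γ)
    (x : L) (hx : x ≠ 0) :
    ∃ N : ℕ, 0 < N ∧ ∃ a : K, a ≠ 0 ∧ v x ^ N = v (algebraMap K L a) := by
  classical
  obtain ⟨p, hp0, hp⟩ := Algebra.IsAlgebraic.isAlgebraic (R := K) x
  rw [Polynomial.aeval_eq_sum_range, ] at hp
  let s := p.support
  have hs : s.Nonempty := Polynomial.support_nonempty.2 hp0
  let F : ℕ → L := fun i => algebraMap K L (p.coeff i) * x ^ i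
  have hF : ∑ i ∈ s, F i = 0 := by
    rw [← hp, ← Polynomial.aeval_eq_sum_range, Polynomial.aeval_def, Polynomial.eval₂_eq_sum,
      Polynomial.sum_def]
  have hFne : ∀ i ∈ s, F i ≠ 0 := fun i hi =>
    mul_ne_zero (by simpa using Polynomial.mem_support_iff.1 hi) (pow_ne_zero _ hx)
  obtain ⟨i, hi, hmax⟩ := s.exists_max_image (fun i => v (F i)) hs
  have key : ∃ j ∈ s, j ≠ i ∧ v (F j) = v (F i) := by
    by_contra! hcon
    have := v.map_sum_eq_of_lt (s := s) (f := F) hi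
      (fun j hj => lt_of_le_of_ne (hmax j (Finset.mem_sdiff.1 hj).1)
        (hcon j (Finset.mem_sdiff.1 hj).1 (by simpa using (Finset.mem_sdiff.1 hj).2)))
    rw [hF, map_zero] at this
    exact hFne i hi ((map_eq_zero v).1 this.symm)
  obtain ⟨j, hj, hji, he⟩ := key
  have aux : ∀ i j : ℕ, i ∈ s → j ∈ s → i < j → v (F j) = v (F i) →
      ∃ N : ℕ, 0 < N ∧ ∃ a : K, a ≠ 0 ∧ v x ^ N = v (algebraMap K L a) := by
    intro i j hi hj hij he
    have hci := Polynomial.mem_support_iff.1 hi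
    have hcj := Polynomial.mem_support_iff.1 hj
    refine ⟨j - i, by omega, p.coeff i / p.coeff j, div_ne_zero hci hcj, ?_⟩
    obtain ⟨d, rfl⟩ := Nat.exists_eq_add_of_lt hij
    have hvx : v x ^ i ≠ 0 := pow_ne_zero _ (by simpa using hx)
    have hvj : v (algebraMap K L (p.coeff (i + d + 1))) ≠ 0 := by simpa using hcj
    have e : i + d + 1 - i = d + 1 := by omega
    simp only [F, map_mul, map_pow] at he
    rw [e, map_div₀, map_div₀, eq_div_iff hvj]
    apply mul_right_cancel₀ hvx
    rw [← he, mul_comm (_ ^ (d + 1)), mul_assoc, ← pow_add]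
    congr 2
    omega
  rcases lt_or_gt_of_ne hji with h | h
  · exact aux j i hj hi h he.symm
  · exact aux i j hi hj h he

/-- A valuation ring of `L` that contains the integral closure `R` of `A` and lies over `P`
contains only fractions with denominators outside `P`. -/
theorem exists_mul_eq_of_val_le_one {A K L Γ : Type*} [CommRing A] [IsDedekindDomain A]
    [Field K] [Algebra A K] [IsFractionRing A K] [Field L] [Algebra K L] [Algebra A L]
    [IsScalarTower A K L] [Algebra.IsAlgebraic K L] [LinearOrderedCommGroupWithZero Γ]
    (v : Valuation L Γ) (p : IsDedekindDomain.HeightOneSpectrum A)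
    (h1 : ∀ a : K, v (algebraMap K L a) ≤ 1 → p.valuation K a ≤ 1)
    (h2 : ∀ t : A, t ∉ p.asIdeal → v (algebraMap A L t) = 1)
    (x : L) (hx : v x ≤ 1) :
    ∃ a s : integralClosure A L, v (s : L) = 1 ∧ x * s = a := by
  classical
  obtain ⟨f, hf0, hf⟩ := Algebra.IsAlgebraic.isAlgebraic (R := K) x
  have hs : f.support.Nonempty := Polynomial.support_nonempty.2 hf0
  let φ : ℕ → Γ := fun i => v (algebraMap K L (f.coeff i))
  obtain ⟨i₀, hi₀, hmax₀⟩ := f.support.exists_max_image φ hs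
  let T := f.support.filter (fun i => φ i = φ i₀)
  have hT : T.Nonempty := ⟨i₀, by simp [T, Polynomial.mem_support_iff.1 hi₀]⟩
  let k := T.max' hT
  have hkT : k ∈ T := T.max'_mem hT
  have hk : f.coeff k ≠ 0 := Polynomial.mem_support_iff.1 (Finset.mem_filter.1 hkT).1
  have hφk : φ k = φ i₀ := (Finset.mem_filter.1 hkT).2
  have hφk0 : 0 < φ k := by simpa [φ, zero_lt_iff] using hk
  have hle : ∀ i, φ i ≤ φ k := by
    intro i
    by_cases hi : i ∈ f.support
    · rw [hφk]; exact hmax₀ i hi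
    · simp [φ, Polynomial.notMem_support_iff.1 hi]
  have hlt : ∀ i, k < i → φ i < φ k := by
    intro i hki
    refine lt_of_le_of_ne (hle i) fun he => ?_
    have : i ∈ T := by
      refine Finset.mem_filter.2 ⟨Polynomial.mem_support_iff.2 fun h0 => ?_, he.trans hφk⟩
      rw [← he] at hφk0
      simp [φ, h0] at hφk0
    exact absurd (T.le_max' i this) (not_le.2 hki)
  -- normalized coefficients and a common denominator
  let c : ℕ → K := fun i => f.coeff i / f.coeff k
  have hc : ∀ i, v (algebraMap K L (c i)) = φ i / φ k := fun i => by simp [c, φ]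
  have hden : ∀ n : ℕ, ∃ t : A, t ∉ p.asIdeal ∧ ∀ i < n, ∃ e : A,
      algebraMap A K t * c i = algebraMap A K e := by
    intro n
    induction n with
    | zero => exact ⟨1, fun h => p.isPrime.ne_top ((Ideal.eq_top_iff_one _).2 h), by simp⟩
    | succ n ih =>
      obtain ⟨t, ht, h⟩ := ih
      obtain ⟨b, d, hbd⟩ := p.exists_primeCompl_mul_eq_of_integer (K := K) (c n)
        (h1 _ (by rw [hc]; exact div_le_one_of_le₀ (hle n) zero_le))
      refine ⟨t * d, fun hm => (p.isPrime.mem_or_mem hm).elim ht d.2, fun i hi => ?_⟩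
      rcases Nat.lt_succ_iff_lt_or_eq.1 hi with hi | rfl
      · obtain ⟨e, he⟩ := h i hi
        exact ⟨e * d, by rw [map_mul, map_mul, ← he]; ring⟩
      · exact ⟨t * b, by rw [map_mul, map_mul, ← hbd]; ring⟩
  obtain ⟨t, ht, he⟩ := hden (f.natDegree + 1)
  choose! e he using he
  set n := f.natDegree + 1 with hn
  have hkn : k < n := Nat.lt_succ_of_le (Polynomial.le_natDegree_of_ne_zero hk)
  have heL : ∀ i < n, algebraMap A L (e i) = algebraMap A L t * algebraMap K L (c i) := by
    intro i hi
    rw [IsScalarTower.algebraMap_apply A K L, ← he i hi, map_mul,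
      ← IsScalarTower.algebraMap_apply A K L]
  have hsum : ∑ i ∈ Finset.range n, algebraMap A L (e i) * x ^ i = 0 := by
    have hk' : algebraMap K L (f.coeff k) ≠ 0 := by simpa using hk
    have : ∑ i ∈ Finset.range n, algebraMap A L (e i) * x ^ i =
        algebraMap A L t / algebraMap K L (f.coeff k) * Polynomial.aeval x f := by
      rw [Polynomial.aeval_eq_sum_range, Finset.mul_sum]
      refine Finset.sum_congr rfl fun i hi => ?_
      rw [heL i (Finset.mem_range.1 hi), Algebra.smul_def]
      simp only [c, map_div₀]
      ring
    rw [this, hf, mul_zero]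
  -- the two elements
  let Y : L := ∑ i ∈ Finset.Ico k n, algebraMap A L (e i) * x ^ (i - k)
  have hsplit : ∑ i ∈ Finset.range k, algebraMap A L (e i) * x ^ i + x ^ k * Y = 0 := by
    rw [← hsum, ← Finset.sum_range_add_sum_Ico _ hkn.le]
    congr 1
    rw [Finset.mul_sum]
    refine Finset.sum_congr rfl fun i hi => ?_
    have := (Finset.mem_Ico.1 hi).1
    rw [mul_left_comm, ← pow_add, Nat.add_sub_cancel' this]
  have hmem : ∀ W : ValuationSubring L, (integralClosure A L).toSubring ≤ W.toSubring →
      Y ∈ W ∧ x * Y ∈ W := by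
    intro W hW
    have hA : ∀ a : A, algebraMap A L a ∈ W := fun a =>
      hW (show algebraMap A L a ∈ integralClosure A L from isIntegral_algebraMap)
    rcases W.mem_or_inv_mem x with hxW | hxW
    · have : Y ∈ W := sum_mem fun i _ => mul_mem (hA _) (pow_mem hxW _)
      exact ⟨this, mul_mem hxW this⟩
    · by_cases hx0 : x = 0
      · have hxW' : x ∈ W := by rw [hx0]; exact W.zero_mem
        have : Y ∈ W := sum_mem fun i _ => mul_mem (hA _) (pow_mem hxW' _)
        exact ⟨this, mul_mem hxW' this⟩
      have hZ : x * Y = - ∑ i ∈ Finset.range k, algebraMap A L (e i) * x⁻¹ ^ (k - i - 1) := by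
        have hxk : x ^ k ≠ 0 := pow_ne_zero _ hx0
        have h3 : x ^ k * Y = - ∑ i ∈ Finset.range k, algebraMap A L (e i) * x ^ i :=
          eq_neg_of_add_eq_zero_right hsplit
        apply mul_left_cancel₀ hxk
        rw [mul_left_comm, h3, mul_neg, mul_neg, Finset.mul_sum, Finset.mul_sum]
        congr 1
        refine Finset.sum_congr rfl fun i hi => ?_
        obtain ⟨d, hd⟩ := Nat.exists_eq_add_of_lt (Finset.mem_range.1 hi)
        have e1 : k - i - 1 = d := by omega
        rw [e1, hd, inv_pow]
        field_simp
        ring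
      have hZm : x * Y ∈ W := by
        rw [hZ]
        exact neg_mem (sum_mem fun i _ => mul_mem (hA _) (pow_mem hxW _))
      refine ⟨?_, hZm⟩
      have : Y = x⁻¹ * (x * Y) := by rw [inv_mul_cancel_left₀ hx0]
      rw [this]
      exact mul_mem hxW hZm
  have hint : ∀ y : L, (∀ W : ValuationSubring L,
      (integralClosure A L).toSubring ≤ W.toSubring → y ∈ W) → y ∈ integralClosure A L := by
    intro y hy
    by_contra hcon
    obtain ⟨W, hW, hyW⟩ := Subring.exists_le_valuationSubring_of_isIntegrallyClosedIn
      (R := (integralClosure A L).toSubring) (x := y) hcon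
    exact hyW (hy W hW)
  refine ⟨⟨x * Y, hint _ fun W hW => (hmem W hW).2⟩, ⟨Y, hint _ fun W hW => (hmem W hW).1⟩, ?_, rfl⟩
  have hvt := h2 t ht
  have hY : Y = algebraMap A L t +
      ∑ i ∈ Finset.Ico (k + 1) n, algebraMap A L (e i) * x ^ (i - k) := by
    simp only [Y]
    rw [Finset.sum_eq_sum_Ico_succ_bot hkn, heL k hkn]
    simp [c, hk]
  have hrest : v (∑ i ∈ Finset.Ico (k + 1) n, algebraMap A L (e i) * x ^ (i - k)) < 1 := by
    refine v.map_sum_lt one_ne_zero fun i hi => ?_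
    have hi' := Finset.mem_Ico.1 hi
    rw [map_mul, map_pow, heL i hi'.2, map_mul, hvt, one_mul, hc]
    exact mul_lt_one_of_lt_of_le ((div_lt_one₀ hφk0).2 (hlt i hi'.1)) (pow_le_one' hx _)
  show v Y = 1
  rw [hY, v.map_add_eq_of_lt_left (by rw [hvt]; exact hrest), hvt]

/-- `v` is an additive valuation of `L` corresponding to the maximal ideal `P` of the integral
closure of `A` in `L` (its valuation ring is the localization at `P`), normalized by
`v (Kˣ) = ℤ`. -/
def IsNormalizedValuation (A K L : Type*) [CommRing A] [Field K] [Field L] [Algebra K L]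
    [Algebra A L] (P : Ideal (integralClosure A L)) (v : AddValuation L (WithTop ℚ)) : Prop :=
  (∀ x : L, 0 ≤ v x ↔ ∃ a s : integralClosure A L, s ∉ P ∧ x * (s : L) = (a : L)) ∧
  {q : WithTop ℚ | ∃ a : K, a ≠ 0 ∧ v (algebraMap K L a) = q} =
    Set.range (fun n : ℤ => ((n : ℚ) : WithTop ℚ))

theorem exists_isNormalizedValuation {A K L : Type*} [CommRing A] [IsDedekindDomain A]
    (hA : ¬ IsField A) [Field K] [Algebra A K] [IsFractionRing A K] [Field L] [Algebra K L]
    [Algebra A L] [IsScalarTower A K L] [Algebra.IsAlgebraic K L]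
    (P : Ideal (integralClosure A L)) [hP : P.IsMaximal] :
    ∃ v : AddValuation L (WithTop ℚ), IsNormalizedValuation A K L P v := by
  classical
  -- the prime below
  have hmax : (P.comap (algebraMap A (integralClosure A L))).IsMaximal :=
    Ideal.isMaximal_comap_of_isIntegral_of_isMaximal P
  let p : IsDedekindDomain.HeightOneSpectrum A :=
    ⟨P.comap (algebraMap A (integralClosure A L)), hmax.isPrime,
      Ring.ne_bot_of_isMaximal_of_not_isField hmax hA⟩
  -- a valuation ring above `P`
  obtain ⟨V, hV, hPV⟩ := Ideal.image_subset_nonunits_valuationSubring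
    (A := (integralClosure A L).toSubring) P hP.ne_top
  let v := V.valuation
  have hle : ∀ a : integralClosure A L, v (a : L) ≤ 1 := fun a =>
    (V.valuation_le_one_iff _).2 (hV a.2)
  have hlt : ∀ a : integralClosure A L, a ∈ P → v (a : L) < 1 := fun a ha =>
    V.mem_nonunits_iff.1 (hPV ⟨a, ha, rfl⟩)
  have heq : ∀ a : integralClosure A L, a ∉ P → v (a : L) = 1 := by
    intro a ha
    refine le_antisymm (hle a) (not_lt.1 fun hcon => ?_)
    obtain ⟨b, c, hc, h⟩ := hP.exists_inv ha
    have h' : (b : L) * (a : L) + (c : L) = 1 := congrArg Subtype.val h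
    have : v ((b : L) * (a : L) + (c : L)) < 1 :=
      v.map_add_lt (by rw [map_mul]; exact (mul_le_of_le_one_left' (hle b)).trans_lt hcon) (hlt c hc)
    rw [h', map_one] at this
    exact lt_irrefl _ this
  have hpe : ∀ t : A, t ∉ p.asIdeal → v (algebraMap A L t) = 1 := fun t ht =>
    heq (algebraMap A (integralClosure A L) t) ht
  have hpl : ∀ t : A, t ∈ p.asIdeal → v (algebraMap A L t) < 1 := fun t ht =>
    hlt (algebraMap A (integralClosure A L) t) ht
  -- comparison on `K`
  have hK : ∀ a : K, p.valuation K a ≤ 1 → ∃ (b d : A), d ∉ p.asIdeal ∧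
      a * algebraMap A K d = algebraMap A K b ∧ v (algebraMap K L a) = v (algebraMap A L b) := by
    intro a ha
    obtain ⟨b, d, h⟩ := p.exists_primeCompl_mul_eq_of_integer (K := K) a ha
    refine ⟨b, d, d.2, h, ?_⟩
    have := congrArg (fun y => v (algebraMap K L y)) h
    simp only [map_mul, ← IsScalarTower.algebraMap_apply A K L] at this
    rwa [hpe d d.2, mul_one] at this
  have hKle : ∀ a : K, p.valuation K a ≤ 1 → v (algebraMap K L a) ≤ 1 := by
    intro a ha
    obtain ⟨b, d, -, -, h⟩ := hK a ha
    rw [h]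
    exact hle (algebraMap A (integralClosure A L) b)
  have hKlt : ∀ a : K, p.valuation K a < 1 → v (algebraMap K L a) < 1 := by
    intro a ha
    obtain ⟨b, d, hd, h, h'⟩ := hK a ha.le
    rw [h']
    refine hpl b ?_
    have := congrArg (p.valuation K) h
    rw [map_mul, p.valuation_eq_one_iff_notMem.2 hd, mul_one] at this
    rw [← p.valuation_lt_one_iff_mem (K := K), ← this]
    exact ha
  have hKle' : ∀ a : K, v (algebraMap K L a) ≤ 1 → p.valuation K a ≤ 1 := by
    intro a ha
    by_contra hcon
    have hcon := not_le.1 hcon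
    have := hKlt a⁻¹ (by rw [map_inv₀]; exact inv_lt_one_of_one_lt₀ hcon)
    rw [map_inv₀, map_inv₀] at this
    have ha0 : 0 < v (algebraMap K L a) := by
      rw [zero_lt_iff]
      intro h0
      have : a = 0 := by simpa using h0
      rw [this, map_zero] at hcon
      exact absurd hcon (by simp)
    exact absurd ha (not_le.2 ((inv_lt_one₀ ha0).1 this))
  obtain ⟨π, hπ⟩ := p.valuation_exists_uniformizer K
  have hπ0 : π ≠ 0 := by
    rintro rfl
    rw [map_zero] at hπ
    exact absurd hπ.symm (by simp)
  let g := v (algebraMap K L π)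
  have hg0 : 0 < g := by
    rw [zero_lt_iff]
    simpa [g] using hπ0
  have hg1 : g < 1 := hKlt π (by rw [hπ]; decide)
  have hKpow : ∀ a : K, a ≠ 0 → ∃ n : ℤ, v (algebraMap K L a) = g ^ n := by
    intro a ha
    have hpa : p.valuation K a ≠ 0 := by simpa using ha
    let k : ℤ := (p.valuation K a).log
    have hone : p.valuation K (a * π ^ k) = 1 := by
      rw [map_mul, map_zpow₀, hπ, ← WithZero.exp_log hpa, ← WithZero.exp_zsmul,
        ← WithZero.exp_add]
      simp [k]
    have hu : v (algebraMap K L (a * π ^ k)) = 1 := by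
      refine le_antisymm (hKle _ hone.le) ?_
      have := hKle (a * π ^ k)⁻¹ (by rw [map_inv₀, hone, inv_one])
      rw [map_inv₀, map_inv₀] at this
      have h0 : 0 < v (algebraMap K L (a * π ^ k)) := by
        rw [zero_lt_iff]
        simpa using ⟨ha, zpow_ne_zero k (by simpa using hπ0)⟩
      exact (inv_le_one₀ h0).1 this
    refine ⟨-k, ?_⟩
    rw [map_mul, map_zpow₀, map_mul, map_zpow₀] at hu
    rw [zpow_neg]
    exact eq_inv_of_mul_eq_one_left hu
  obtain ⟨w, hw, hwg⟩ := exists_addValuation v g hg0 hg1 (by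
    intro x hx
    obtain ⟨N, hN, a, ha, h⟩ := exists_pow_val_eq (K := K) v x hx
    obtain ⟨n, hn⟩ := hKpow a ha
    exact ⟨N, hN, n, h.trans hn⟩)
  refine ⟨w, fun x => ?_, Set.ext fun q => ⟨?_, ?_⟩⟩
  · rw [hw]
    constructor
    · intro hx
      obtain ⟨a, s, hs, h⟩ := exists_mul_eq_of_val_le_one v p hKle' hpe x hx
      exact ⟨a, s, fun hsP => (hlt s hsP).ne hs, h⟩
    · rintro ⟨a, s, hs, h⟩
      have := congrArg v h
      rw [map_mul, heq s hs, mul_one] at this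
      rw [this]
      exact hle a
  · rintro ⟨a, ha, rfl⟩
    obtain ⟨n, hn⟩ := hKpow a ha
    exact ⟨n, (hwg _ n hn).symm⟩
  · rintro ⟨n, rfl⟩
    exact ⟨π ^ n, zpow_ne_zero _ hπ0, hwg _ n (by rw [map_zpow₀, map_zpow₀])⟩

theorem isNormalizedValuation_unique {A K L : Type*} [CommRing A] [Field K] [Field L]
    [Algebra K L] [Algebra A L] (P : Ideal (integralClosure A L))
    (v w : AddValuation L (WithTop ℚ)) (hv : IsNormalizedValuation A K L P v)
    (hw : IsNormalizedValuation A K L P w) : v = w := by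
  have hring : ∀ x : L, 0 ≤ v x → 0 ≤ w x := fun x hx => (hw.1 x).2 ((hv.1 x).1 hx)
  have hinv : ∀ (u : AddValuation L (WithTop ℚ)) (x : L), x ≠ 0 → u x + u x⁻¹ = 0 := by
    intro u x hx
    rw [← u.map_mul, mul_inv_cancel₀ hx, u.map_one]
  have hzero : ∀ x : L, v x = 0 → w x = 0 := by
    intro x hx
    have hx0 : x ≠ 0 := by
      rintro rfl
      rw [v.map_zero] at hx
      exact WithTop.top_ne_zero hx
    have h1 := hinv v x hx0
    rw [hx, zero_add] at h1
    have h2 := hring x hx.ge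
    have h3 := hring x⁻¹ h1.ge
    exact le_antisymm ((le_add_of_nonneg_right h3).trans (hinv w x hx0).le) h2
  have hcongr : ∀ x y : L, y ≠ 0 → v x = v y → w x = w y := by
    intro x y hy hxy
    have h1 : v (x * y⁻¹) = 0 := by rw [v.map_mul, hxy, hinv v y hy]
    have h2 := hzero _ h1
    calc w x = w (x * y⁻¹ * y) := by rw [inv_mul_cancel_right₀ hy]
      _ = w y := by rw [w.map_mul, h2, zero_add]
  obtain ⟨π, hπ0, hπ⟩ : (((1 : ℤ) : ℚ) : WithTop ℚ) ∈
      {q : WithTop ℚ | ∃ a : K, a ≠ 0 ∧ v (algebraMap K L a) = q} := hv.2 ▸ ⟨1, rfl⟩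
  have hπL : algebraMap K L π ≠ 0 := by simpa using hπ0
  -- values on `K`, up to the factor `w π`
  have hK : ∀ (a : K) (n : ℤ), a ≠ 0 → v (algebraMap K L a) = ((n : ℚ) : WithTop ℚ) →
      ∀ m : ℚ, w (algebraMap K L π) = (m : WithTop ℚ) →
        w (algebraMap K L a) = ((n * m : ℚ) : WithTop ℚ) := by
    intro a n ha hn m hm
    rcases n.eq_nat_or_neg with ⟨k, rfl | rfl⟩
    · have h1 := hcongr (algebraMap K L a) (algebraMap K L π ^ k) (pow_ne_zero _ hπL) (by
        rw [hn, v.map_pow, hπ, ← WithTop.coe_nsmul]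
        simp)
      rw [h1, w.map_pow, hm, ← WithTop.coe_nsmul]
      simp
    · have h1 := hzero (algebraMap K L a * algebraMap K L π ^ k) (by
        rw [v.map_mul, hn, v.map_pow, hπ, ← WithTop.coe_nsmul, ← WithTop.coe_add]
        simp)
      rw [w.map_mul, w.map_pow, hm, ← WithTop.coe_nsmul] at h1
      cases h : w (algebraMap K L a) with
      | top => rw [h] at h1; simp at h1
      | coe b =>
        rw [h, ← WithTop.coe_add] at h1
        have h2 : b + k • m = 0 := by exact_mod_cast h1
        rw [WithTop.coe_inj]
        rw [nsmul_eq_mul] at h2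
        push_cast
        linarith
  obtain ⟨m, hm⟩ : w (algebraMap K L π) ∈ Set.range (fun n : ℤ => ((n : ℚ) : WithTop ℚ)) :=
    hw.2 ▸ ⟨π, hπ0, rfl⟩
  have hm0 : 0 ≤ m := by
    have := hring (algebraMap K L π) (by rw [hπ]; simp)
    rw [← hm] at this
    have h2 : ((0 : ℚ) : WithTop ℚ) ≤ ((m : ℚ) : WithTop ℚ) := this
    exact_mod_cast WithTop.coe_le_coe.1 h2
  have hm1 : m = 1 := by
    obtain ⟨a, ha0, ha⟩ : (((1 : ℤ) : ℚ) : WithTop ℚ) ∈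
      {q : WithTop ℚ | ∃ a : K, a ≠ 0 ∧ w (algebraMap K L a) = q} := hw.2 ▸ ⟨1, rfl⟩
    obtain ⟨n, hn⟩ : v (algebraMap K L a) ∈ Set.range (fun n : ℤ => ((n : ℚ) : WithTop ℚ)) :=
      hv.2 ▸ ⟨a, ha0, rfl⟩
    have h1 := hK a n ha0 hn.symm m hm.symm
    rw [ha, WithTop.coe_inj] at h1
    have h2 : (1 : ℤ) = n * m := by exact_mod_cast h1
    exact Int.eq_one_of_dvd_one hm0 ⟨n, by rw [h2, mul_comm]⟩
  have hKeq : ∀ (a : K) (n : ℤ), a ≠ 0 → v (algebraMap K L a) = ((n : ℚ) : WithTop ℚ) →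
      w (algebraMap K L a) = ((n : ℚ) : WithTop ℚ) := by
    intro a n ha hn
    rw [hK a n ha hn m hm.symm, hm1, Int.cast_one, mul_one]
  ext x
  by_cases hx : x = 0
  · rw [hx, v.map_zero, w.map_zero]
  cases hq : v x with
  | top => exact absurd (v.top_iff.1 hq) hx
  | coe q =>
    obtain ⟨a, ha0, ha⟩ : ((q.num : ℚ) : WithTop ℚ) ∈
      {q : WithTop ℚ | ∃ a : K, a ≠ 0 ∧ v (algebraMap K L a) = q} := hv.2 ▸ ⟨q.num, rfl⟩
    have h1 := hcongr (x ^ q.den) (algebraMap K L a) (by simpa using ha0) (by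
      rw [v.map_pow, hq, ha, ← WithTop.coe_nsmul, nsmul_eq_mul, Rat.den_mul_eq_num])
    rw [hKeq a q.num ha0 ha, w.map_pow] at h1
    cases hr : w x with
    | top => exact absurd (w.top_iff.1 hr) hx
    | coe r =>
      rw [hr, ← WithTop.coe_nsmul, WithTop.coe_inj, nsmul_eq_mul] at h1
      rw [WithTop.coe_inj]
      have hd : (q.den : ℚ) ≠ 0 := by exact_mod_cast q.den_nz
      exact mul_left_cancel₀ hd ((Rat.den_mul_eq_num q).trans h1.symm)

theorem existsUnique_isNormalizedValuation {A K L : Type*} [CommRing A] [IsDedekindDomain A]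
    (hA : ¬ IsField A) [Field K] [Algebra A K] [IsFractionRing A K] [Field L] [Algebra K L]
    [Algebra A L] [IsScalarTower A K L] [Algebra.IsAlgebraic K L]
    (P : Ideal (integralClosure A L)) [hP : P.IsMaximal] :
    ∃! v : AddValuation L (WithTop ℚ), IsNormalizedValuation A K L P v := by
  obtain ⟨v, hv⟩ := exists_isNormalizedValuation (K := K) hA P
  exact ⟨v, hv, fun w hw => isNormalizedValuation_unique P w v hw hv⟩

/-! ### The totally ordered monoid `ℝ × {0, 1}` -/

/-- The set `ℝ × {0, 1}`. -/
@[ext]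
structure RTilde where
  fst : ℝ
  snd : Fin 2

namespace RTilde

/-- The lexicographic order. -/
noncomputable instance : LinearOrder RTilde :=
  LinearOrder.lift' (fun a : RTilde => toLex (a.fst, a.snd)) (fun a b h => by
    have h' : (a.fst, a.snd) = (b.fst, b.snd) := toLex.injective h
    exact RTilde.ext (congrArg Prod.fst h') (congrArg Prod.snd h'))

theorem lt_iff (a b : RTilde) : a < b ↔ a.fst < b.fst ∨ (a.fst = b.fst ∧ a.snd < b.snd) :=
  Prod.Lex.lt_iff (x := toLex (a.fst, a.snd)) (y := toLex (b.fst, b.snd))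

theorem le_iff (a b : RTilde) : a ≤ b ↔ a.fst < b.fst ∨ (a.fst = b.fst ∧ a.snd ≤ b.snd) :=
  Prod.Lex.le_iff (x := toLex (a.fst, a.snd)) (y := toLex (b.fst, b.snd))

instance : Zero RTilde := ⟨⟨0, 0⟩⟩

noncomputable instance : Add RTilde := ⟨fun a b => ⟨a.fst + b.fst, max a.snd b.snd⟩⟩

@[simp] theorem zero_fst : (0 : RTilde).fst = 0 := rfl
@[simp] theorem zero_snd : (0 : RTilde).snd = 0 := rfl
@[simp] theorem add_fst (a b : RTilde) : (a + b).fst = a.fst + b.fst := rfl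
@[simp] theorem add_snd (a b : RTilde) : (a + b).snd = max a.snd b.snd := rfl

noncomputable instance : AddCommMonoid RTilde where
  add_assoc _ _ _ := RTilde.ext (add_assoc _ _ _) (max_assoc _ _ _)
  zero_add _ := RTilde.ext (zero_add _) (max_eq_right (Fin.zero_le _))
  add_zero _ := RTilde.ext (add_zero _) (max_eq_left (Fin.zero_le _))
  add_comm _ _ := RTilde.ext (add_comm _ _) (max_comm _ _)
  nsmul := nsmulRec

instance : IsOrderedAddMonoid RTilde where
  add_le_add_left _ _ h c := by
    rw [le_iff] at h ⊢
    rcases h with h | ⟨h, h'⟩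
    · exact Or.inl (add_lt_add_left h _)
    · exact Or.inr ⟨congrArg (· + c.fst) h, max_le_max h' le_rfl⟩

/-- The involution `(α, s) ↦ (-α, s)`. -/
noncomputable def iota : RTilde →+ RTilde where
  toFun a := ⟨-a.fst, a.snd⟩
  map_zero' := RTilde.ext neg_zero rfl
  map_add' _ _ := RTilde.ext (neg_add _ _) rfl

theorem exists_lt_add (a b c : RTilde) (h : a + b < c) :
    ∃ a' b' : RTilde, a < a' ∧ b < b' ∧ ∀ u v : RTilde, u < a' → v < b' → u + v < c := by
  rw [lt_iff] at h
  simp only [add_fst, add_snd] at h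
  rcases h with h | ⟨h, h'⟩
  · refine ⟨⟨a.fst + (c.fst - a.fst - b.fst) / 2, 0⟩, ⟨b.fst + (c.fst - a.fst - b.fst) / 2, 0⟩,
      (lt_iff _ _).2 (Or.inl ?_), (lt_iff _ _).2 (Or.inl ?_), fun u v hu hv => ?_⟩
    · dsimp only; linarith
    · dsimp only; linarith
    · rw [lt_iff] at hu hv ⊢
      have hu' := hu.resolve_right fun h => absurd h.2 (Fin.not_lt_zero _)
      have hv' := hv.resolve_right fun h => absurd h.2 (Fin.not_lt_zero _)
      refine Or.inl ?_
      rw [add_fst]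
      dsimp only at hu' hv'
      linarith
  · rw [max_lt_iff] at h'
    refine ⟨⟨a.fst, c.snd⟩, ⟨b.fst, c.snd⟩, (lt_iff _ _).2 (Or.inr ⟨rfl, h'.1⟩),
      (lt_iff _ _).2 (Or.inr ⟨rfl, h'.2⟩), fun u v hu hv => ?_⟩
    rw [lt_iff] at hu hv ⊢
    rw [add_fst, add_snd]
    dsimp only at hu hv
    rcases hu with hu | ⟨hu, hu'⟩ <;> rcases hv with hv | ⟨hv, hv'⟩
    · left; linarith
    · left; linarith
    · left; linarith
    · right
      exact ⟨by linarith, max_lt hu' hv'⟩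

end RTilde

/-! ### Upper semicontinuous functions with values in `ℝ × {0, 1}` -/

theorem RTilde.upperSemicontinuous_add {X : Type*} [TopologicalSpace X] {f g : X → RTilde}
    (hf : UpperSemicontinuous f) (hg : UpperSemicontinuous g) : UpperSemicontinuous (f + g) := by
  intro x c hc
  obtain ⟨a, b, ha, hb, h⟩ := RTilde.exists_lt_add (f x) (g x) c hc
  filter_upwards [hf x a ha, hg x b hb] with y h1 h2
  exact h _ _ h1 h2

/-- The monoid of upper semicontinuous, bounded, compactly supported functions
`X → ℝ × {0, 1}`. -/
noncomputable def suZeroB (X : Type*) [TopologicalSpace X] : AddSubmonoid (X → RTilde) where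
  carrier := {f | UpperSemicontinuous f ∧ (BddAbove (Set.range f) ∧ BddBelow (Set.range f)) ∧
    ∃ Y : Set X, IsCompact Y ∧ ∀ x, x ∉ Y → f x = 0}
  zero_mem' := by
    refine ⟨upperSemicontinuous_const, ⟨⟨0, ?_⟩, ⟨0, ?_⟩⟩, ∅, isCompact_empty, fun _ _ => rfl⟩
    · rintro _ ⟨x, rfl⟩; exact le_rfl
    · rintro _ ⟨x, rfl⟩; exact le_rfl
  add_mem' := by
    rintro f g ⟨hf, ⟨⟨a, ha⟩, ⟨b, hb⟩⟩, Y, hY, hfY⟩ ⟨hg, ⟨⟨c, hc⟩, ⟨d, hd⟩⟩, Z, hZ, hgZ⟩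
    refine ⟨RTilde.upperSemicontinuous_add hf hg, ⟨⟨a + c, ?_⟩, ⟨b + d, ?_⟩⟩, Y ∪ Z,
      hY.union hZ, fun x hx => ?_⟩
    · rintro _ ⟨x, rfl⟩; exact add_le_add (ha ⟨x, rfl⟩) (hc ⟨x, rfl⟩)
    · rintro _ ⟨x, rfl⟩; exact add_le_add (hb ⟨x, rfl⟩) (hd ⟨x, rfl⟩)
    · rw [Pi.add_apply, hfY x fun h => hx (Or.inl h), hgZ x fun h => hx (Or.inr h), add_zero]

/-- The monoid of reflexible functions: `f` and `ι ∘ f` both lie in `suZeroB X`. -/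
noncomputable def suZeroRef (X : Type*) [TopologicalSpace X] : AddSubmonoid (X → RTilde) where
  carrier := {f | f ∈ suZeroB X ∧ RTilde.iota ∘ f ∈ suZeroB X}
  zero_mem' := by
    refine ⟨zero_mem _, ?_⟩
    have : RTilde.iota ∘ (0 : X → RTilde) = 0 := funext fun _ => map_zero RTilde.iota
    rw [this]
    exact zero_mem _
  add_mem' := by
    rintro f g ⟨hf, hf'⟩ ⟨hg, hg'⟩
    refine ⟨add_mem hf hg, ?_⟩
    have : RTilde.iota ∘ (f + g) = RTilde.iota ∘ f + RTilde.iota ∘ g :=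
      funext fun _ => map_add RTilde.iota _ _
    rw [this]
    exact add_mem hf' hg'

/-! ### The maximal spectrum with the Krull-like topology -/

/-- The set of maximal ideals of `R`; a type synonym, so that it does not carry the Zariski
topology. -/
def MSpec (R : Type*) [CommRing R] : Type _ := MaximalSpectrum R

/-- The underlying maximal ideal. -/
def MSpec.ideal {R : Type*} [CommRing R] (P : MSpec R) : Ideal R := MaximalSpectrum.asIdeal P

instance {R : Type*} [CommRing R] (P : MSpec R) : P.ideal.IsMaximal := MaximalSpectrum.isMaximal P

/-- The set of maximal ideals that contain the finite set `A`. -/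
def MSpec.basicOpen {R : Type*} [CommRing R] (A : Finset R) : Set (MSpec R) :=
  {P | ∀ a ∈ A, a ∈ P.ideal}

/-- The Krull-like topology. -/
instance {R : Type*} [CommRing R] : TopologicalSpace (MSpec R) :=
  TopologicalSpace.generateFrom (Set.range MSpec.basicOpen)

theorem MSpec.isTopologicalBasis (R : Type*) [CommRing R] :
    TopologicalSpace.IsTopologicalBasis (Set.range (MSpec.basicOpen (R := R))) where
  exists_subset_inter := by
    classical
    rintro _ ⟨A, rfl⟩ _ ⟨B, rfl⟩ P ⟨hA, hB⟩
    refine ⟨_, ⟨A ∪ B, rfl⟩, fun a ha => ?_, fun Q hQ => ⟨fun a ha => ?_, fun a ha => ?_⟩⟩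
    · rcases Finset.mem_union.1 ha with h | h
      · exact hA a h
      · exact hB a h
    · exact hQ a (Finset.mem_union_left _ ha)
    · exact hQ a (Finset.mem_union_right _ ha)
  sUnion_eq := Set.sUnion_eq_univ_iff.2 fun P => ⟨_, ⟨∅, rfl⟩, by simp [MSpec.basicOpen]⟩
  eq_generateFrom := rfl

/-! ### Fractional ideals -/

/-- The monoid of (non-zero) fractional ideals of `R` in `L`. -/
def fracIdeals (R L : Type*) [CommRing R] [Field L] [Algebra R L] :
    Submonoid (FractionalIdeal (nonZeroDivisors R) L) where
  carrier := {I | I ≠ 0}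
  one_mem' := fun h => by
    have h1 : (1 : L) ∈ (0 : FractionalIdeal (nonZeroDivisors R) L) := by
      rw [← h]; exact FractionalIdeal.one_mem_one _
    exact one_ne_zero ((FractionalIdeal.mem_zero_iff _).1 h1)
  mul_mem' := by
    intro I J hI hJ hIJ
    have ex : ∀ I : FractionalIdeal (nonZeroDivisors R) L, I ≠ 0 → ∃ x ∈ I, x ≠ 0 := by
      intro I hI
      by_contra! hcon
      exact hI (FractionalIdeal.eq_zero_iff.2 hcon)
    obtain ⟨x, hx, hx0⟩ := ex I hI
    obtain ⟨y, hy, hy0⟩ := ex J hJ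
    have := FractionalIdeal.mul_mem_mul hx hy
    rw [hIJ] at this
    exact mul_ne_zero hx0 hy0 ((FractionalIdeal.mem_zero_iff _).1 this)

/-! ### Values of the valuations -/

section values

variable {A : Type*} (K : Type*) {L : Type*} [CommRing A] [IsDedekindDomain A]
  (hA : ¬ IsField A) [Field K] [Algebra A K] [IsFractionRing A K] [Field L] [Algebra K L]
  [Algebra A L] [IsScalarTower A K L] [Algebra.IsAlgebraic K L]

/-- The additive valuation of `L` corresponding to the maximal ideal `P`, with
`valAt P (Kˣ) = ℤ`. -/
noncomputable def valAt (P : MSpec (integralClosure A L)) : AddValuation L (WithTop ℚ) :=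
  (existsUnique_isNormalizedValuation (K := K) hA P.ideal).choose

theorem valAt_spec (P : MSpec (integralClosure A L)) :
    IsNormalizedValuation A K L P.ideal (valAt K hA P) :=
  (existsUnique_isNormalizedValuation (K := K) hA P.ideal).choose_spec.1

/-- The set of finite values of the valuation at `P` on a subset `S` of `L`, as real numbers. -/
def valuesOn (P : MSpec (integralClosure A L)) (S : Set L) : Set ℝ :=
  {r | ∃ x ∈ S, ∃ q : ℚ, valAt K hA P x = (q : WithTop ℚ) ∧ (q : ℝ) = r}

theorem valuesOn_univ_zero (P : MSpec (integralClosure A L)) :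
    (0 : ℝ) ∈ valuesOn K hA P Set.univ :=
  ⟨1, trivial, 0, (valAt K hA P).map_one, Rat.cast_zero⟩

theorem valuesOn_univ_add (P : MSpec (integralClosure A L)) {r s : ℝ}
    (hr : r ∈ valuesOn K hA P Set.univ) (hs : s ∈ valuesOn K hA P Set.univ) :
    r + s ∈ valuesOn K hA P Set.univ := by
  obtain ⟨x, -, p, hx, rfl⟩ := hr
  obtain ⟨y, -, q, hy, rfl⟩ := hs
  exact ⟨x * y, trivial, p + q, by rw [AddValuation.map_mul, hx, hy]; rfl, Rat.cast_add _ _⟩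

/-- The monoid of the pairs `(α, 0)` with `α` in the value group of `P`. -/
noncomputable def valMonoid (P : MSpec (integralClosure A L)) : AddSubmonoid RTilde where
  carrier := {a | a.fst ∈ valuesOn K hA P Set.univ ∧ a.snd = 0}
  zero_mem' := ⟨valuesOn_univ_zero K hA P, rfl⟩
  add_mem' := by
    rintro a b ⟨ha, ha'⟩ ⟨hb, hb'⟩
    exact ⟨valuesOn_univ_add K hA P ha hb, by rw [RTilde.add_snd, ha', hb', max_self]⟩

/-- The monoid `valMonoid P`, enlarged by all pairs `(β, 1)` if the closure of the value group
of `P` is all of `ℝ`. -/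
noncomputable def valTilde (P : MSpec (integralClosure A L)) : AddSubmonoid RTilde where
  carrier := {a | a ∈ valMonoid K hA P ∨
    (closure (valuesOn K hA P Set.univ) = Set.univ ∧ a.snd = 1)}
  zero_mem' := Or.inl (zero_mem _)
  add_mem' := by
    rintro a b (ha | ⟨h, ha⟩) (hb | ⟨h', hb⟩)
    · exact Or.inl (add_mem ha hb)
    · exact Or.inr ⟨h', by rw [RTilde.add_snd, hb, ha.2]; rfl⟩
    · exact Or.inr ⟨h, by rw [RTilde.add_snd, ha, hb.2]; rfl⟩
    · exact Or.inr ⟨h, by rw [RTilde.add_snd, ha, hb]; rfl⟩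

/-- The functions in `suZeroB` on the maximal spectrum whose value at each `P` is in
`valTilde P`. -/
noncomputable def suZeroBTilde : AddSubmonoid (MSpec (integralClosure A L) → RTilde) :=
  suZeroB (MSpec (integralClosure A L)) ⊓ AddSubmonoid.pi Set.univ (valTilde K hA)

/-- The functions in `suZeroRef` on the maximal spectrum whose value at each `P` is in
`valTilde P`. -/
noncomputable def suZeroRefTilde : AddSubmonoid (MSpec (integralClosure A L) → RTilde) :=
  suZeroRef (MSpec (integralClosure A L)) ⊓ AddSubmonoid.pi Set.univ (valTilde K hA)

/-- The functions in `suZeroRef` on the maximal spectrum whose value at each `P` is in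
`valMonoid P`. -/
noncomputable def suZeroRefVal : AddSubmonoid (MSpec (integralClosure A L) → RTilde) :=
  suZeroRef (MSpec (integralClosure A L)) ⊓ AddSubmonoid.pi Set.univ (valMonoid K hA)

open Classical in
/-- The function attached to a fractional ideal `I`: its value at `P` is `(inf, 0)` or `(inf, 1)`,
where `inf` is the infimum of the valuation at `P` on `I`, according to whether this infimum is
attained or not. -/
noncomputable def idealFun (I : FractionalIdeal (nonZeroDivisors (integralClosure A L)) L)
    (P : MSpec (integralClosure A L)) : RTilde where
  fst := sInf (valuesOn K hA P {x | x ∈ I})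
  snd := if sInf (valuesOn K hA P {x | x ∈ I}) ∈ valuesOn K hA P {x | x ∈ I} then 0 else 1

end values

/-! ### Topology of the maximal spectrum -/

namespace MSpec

variable {R : Type*} [CommRing R]

/-! For fixed `x ≠ 0` in `L`, the function `P ↦ v_P(x)` is locally constant in the Krull-like
topology and vanishes outside a compact set (`isLocallyConstant_valReal`,
`exists_isCompact_valReal_eq_zero`); hence it is bounded. Local constancy holds because the values
on `K` depend only on the prime below `P`, a finitely generated ideal, and some power of `x` is an
element of `K` times a unit at `P`. Compactness comes from that of `basicOpen {a}` for `a ≠ 0`, a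
consequence of dimension one.

The second coordinate of `ℝ × {0, 1}` makes the function of `I` remember which values occur: it is
`≤ (r, 0)` at `P` exactly when some non-zero `x ∈ I` has value at most `r`, and `< (r, 0)` exactly
when some such `x` has value less than `r`. As `(r, 1)` is the successor of `(r, 0)`, every strict
upper bound is witnessed by a single element, whose value is locally constant; this gives upper
semicontinuity. One element of `I` and one common denominator bound the function on both sides.

Injectivity is the local-global principle `mem_iff_forall_idealFun_le`. For surjectivity, `f` is
sent to the module of all `x` with `f ≤ (v(x), 0)` everywhere. The point is that every value allowed
by `f` at one `P` is attained in this module (`exists_forall_le_and_valReal_eq`): an element with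
that value works near `P` by semicontinuity, and a factor outside `P`, highly divisible on the rest
of a compact set, repairs it elsewhere.

Regular and invertible elements are then found by computing in `ℝ × {0, 1}`, where a quasi-inverse
of `a` determines `ι a`. -/

theorem isMaximal (P : MSpec R) : P.ideal.IsMaximal := inferInstance

theorem mem_basicOpen_singleton {a : R} {P : MSpec R} :
    P ∈ basicOpen {a} ↔ a ∈ P.ideal := by
  simp [basicOpen]

theorem eq_of_le {P Q : MSpec R} (h : P.ideal ≤ Q.ideal) : P = Q :=
  MaximalSpectrum.ext
    (P.isMaximal.eq_of_le Q.isMaximal.ne_top h)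

theorem isOpen_basicOpen (A : Finset R) : IsOpen (basicOpen A) :=
  TopologicalSpace.isOpen_generateFrom_of_mem ⟨A, rfl⟩

/-- If `a ∉ P`, then `b * a + c = 1` with `c ∈ P`, and no maximal ideal containing `c` contains `a`.
-/
theorem isClosed_basicOpen_singleton (a : R) : IsClosed (basicOpen ({a} : Finset R)) := by
  rw [← isOpen_compl_iff, isOpen_iff_mem_nhds]
  intro P hP
  have hP' : a ∉ P.ideal := fun h => hP (mem_basicOpen_singleton.2 h)
  obtain ⟨b, c, hc, h⟩ := P.isMaximal.exists_inv hP'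
  refine Filter.mem_of_superset
    ((isOpen_basicOpen {c}).mem_nhds (mem_basicOpen_singleton.2 hc)) fun Q hQ hQa => ?_
  refine Q.isMaximal.ne_top ((Ideal.eq_top_iff_one _).2 ?_)
  rw [← h]
  exact add_mem (Ideal.mul_mem_left _ _ (mem_basicOpen_singleton.1 hQa))
    (mem_basicOpen_singleton.1 hQ)

theorem isOpen_setOf_notMem (a : R) : IsOpen {P : MSpec R | a ∉ P.ideal} := by
  have : {P : MSpec R | a ∉ P.ideal} = (basicOpen {a})ᶜ := by
    ext P
    exact (not_congr mem_basicOpen_singleton).symm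
  rw [this]
  exact (isClosed_basicOpen_singleton a).isOpen_compl

/-- The subbase needed for Alexander's theorem in the compactness proof: covers by sets `basicOpen
{b}` suffice. -/
theorem topology_eq_generateFrom_singleton :
    (inferInstance : TopologicalSpace (MSpec R)) =
      TopologicalSpace.generateFrom (Set.range fun a : R => basicOpen {a}) := by
  refine le_antisymm (le_generateFrom ?_) (le_generateFrom ?_)
  · rintro _ ⟨a, rfl⟩
    exact isOpen_basicOpen {a}
  · rintro _ ⟨A, rfl⟩
    have : basicOpen A = ⋂ a ∈ A, basicOpen {a} := by
      ext P
      simp [basicOpen]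
    rw [this]
    let _ : TopologicalSpace (MSpec R) :=
      TopologicalSpace.generateFrom (Set.range fun a : R => basicOpen {a})
    exact isOpen_biInter_finset fun a _ => TopologicalSpace.isOpen_generateFrom_of_mem ⟨a, rfl⟩

/-- Let the sets `basicOpen {b}`, `b ∈ B`, cover. If no product of elements of `B` were a multiple
of `a`, some prime containing `a` would avoid all these products; being non-zero it is maximal, yet
uncovered. So `a` divides a finite product, and its factors give the subcover. -/
theorem isCompact_basicOpen_singleton [IsDomain R] [Ring.DimensionLEOne R] {a : R} (ha : a ≠ 0) :
    IsCompact (basicOpen ({a} : Finset R)) := by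
  classical
  refine isCompact_generateFrom topology_eq_generateFrom_singleton fun C hC hcov => ?_
  let B : Set R := {b | basicOpen {b} ∈ C}
  by_cases hdis : Disjoint ((Ideal.span {a} : Ideal R) : Set R) (Submonoid.closure B : Set R)
  · exfalso
    obtain ⟨p, hp, hap, hpB⟩ := Ideal.exists_le_prime_disjoint _ _ hdis
    have hap' : a ∈ p := hap (Ideal.mem_span_singleton_self a)
    have hmax : p.IsMaximal := hp.isMaximal fun h => ha (by simpa [h] using hap')
    obtain ⟨U, hU, hpU⟩ := hcov (show (⟨p, hmax⟩ : MaximalSpectrum R) ∈ basicOpen {a} from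
      mem_basicOpen_singleton.2 hap')
    obtain ⟨b, rfl⟩ := hC hU
    exact Set.disjoint_left.1 hpB (mem_basicOpen_singleton.1 hpU) (Submonoid.subset_closure hU)
  · obtain ⟨s, hsa, hs⟩ := Set.not_disjoint_iff.1 hdis
    obtain ⟨l, hl, rfl⟩ := Submonoid.exists_list_of_mem_closure hs
    refine ⟨(fun b => basicOpen {b}) '' {b | b ∈ l}, ?_, l.finite_toSet.image _, fun P hP => ?_⟩
    · rintro _ ⟨b, hb, rfl⟩
      exact hl b hb
    · have hle : Ideal.span {a} ≤ P.ideal := by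
        rw [Ideal.span_singleton_le_iff_mem]
        exact mem_basicOpen_singleton.1 hP
      obtain ⟨b, hb, hbP⟩ :=
        (P.isMaximal.isPrime.multiset_prod_mem_iff_exists_mem l).1
          (by rw [Multiset.prod_coe]; exact hle hsa)
      exact ⟨_, ⟨b, hb, rfl⟩, mem_basicOpen_singleton.2 hbP⟩

end MSpec

/-! ### Real values of the valuations -/

section values

variable {A : Type*} (K : Type*) {L : Type*} [CommRing A] [IsDedekindDomain A]
  (hA : ¬ IsField A) [Field K] [Algebra A K] [IsFractionRing A K] [Field L] [Algebra K L]
  [Algebra A L] [IsScalarTower A K L] [Algebra.IsAlgebraic K L]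

/-- The value of the valuation at `P` on a non-zero element of `L`, as a real number. -/
noncomputable def valReal (P : MSpec (integralClosure A L)) (x : L) : ℝ :=
  -- At `x = 0` the value `⊤` is replaced by `0`, which is why non-vanishing hypotheses accompany
  -- this function.
  ((valAt K hA P x).untopD 0 : ℚ)

theorem valAt_eq_coe (P : MSpec (integralClosure A L)) {x : L} (hx : x ≠ 0) :
    valAt K hA P x = (((valAt K hA P x).untopD 0 : ℚ) : WithTop ℚ) := by
  cases h : valAt K hA P x with
  | top => exact absurd ((valAt K hA P).top_iff.1 h) hx
  | coe q => rfl

theorem valReal_eq_iff (P : MSpec (integralClosure A L)) {x : L} (hx : x ≠ 0) (q : ℚ) :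
    valReal K hA P x = q ↔ valAt K hA P x = (q : WithTop ℚ) := by
  rw [valAt_eq_coe K hA P hx, WithTop.coe_inj, valReal, Rat.cast_inj]

theorem valReal_mul (P : MSpec (integralClosure A L)) {x y : L} (hx : x ≠ 0) (hy : y ≠ 0) :
    valReal K hA P (x * y) = valReal K hA P x + valReal K hA P y := by
  have : valAt K hA P (x * y) = (((valAt K hA P x).untopD 0 + (valAt K hA P y).untopD 0 : ℚ) :
      WithTop ℚ) := by
    rw [AddValuation.map_mul, WithTop.coe_add, ← valAt_eq_coe K hA P hx, ← valAt_eq_coe K hA P hy]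
  rw [(valReal_eq_iff K hA P (mul_ne_zero hx hy) _).2 this, Rat.cast_add]
  rfl

theorem valReal_one (P : MSpec (integralClosure A L)) : valReal K hA P 1 = 0 := by
  have := (valReal_eq_iff K hA P one_ne_zero 0).2 (valAt K hA P).map_one
  rwa [Rat.cast_zero] at this

theorem valReal_inv (P : MSpec (integralClosure A L)) {x : L} (hx : x ≠ 0) :
    valReal K hA P x⁻¹ = - valReal K hA P x := by
  have := valReal_mul K hA P hx (inv_ne_zero hx)
  rw [mul_inv_cancel₀ hx, valReal_one] at this
  linarith

theorem valReal_div (P : MSpec (integralClosure A L)) {x y : L} (hx : x ≠ 0) (hy : y ≠ 0) :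
    valReal K hA P (x / y) = valReal K hA P x - valReal K hA P y := by
  rw [div_eq_mul_inv, valReal_mul K hA P hx (inv_ne_zero hy), valReal_inv K hA P hy, sub_eq_add_neg]

theorem valReal_pow (P : MSpec (integralClosure A L)) {x : L} (hx : x ≠ 0) (n : ℕ) :
    valReal K hA P (x ^ n) = n * valReal K hA P x := by
  induction n with
  | zero => simp [valReal_one]
  | succ n ih =>
    rw [pow_succ, valReal_mul K hA P (pow_ne_zero n hx) hx, ih]
    push_cast
    ring

theorem valReal_zpow (P : MSpec (integralClosure A L)) {x : L} (hx : x ≠ 0) (n : ℤ) :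
    valReal K hA P (x ^ n) = n * valReal K hA P x := by
  rcases n.eq_nat_or_neg with ⟨k, rfl | rfl⟩
  · rw [zpow_natCast, valReal_pow K hA P hx, Int.cast_natCast]
  · rw [zpow_neg, zpow_natCast, valReal_inv K hA P (pow_ne_zero k hx), valReal_pow K hA P hx]
    push_cast
    ring

theorem valReal_le_iff (P : MSpec (integralClosure A L)) {x y : L} (hx : x ≠ 0) (hy : y ≠ 0) :
    valReal K hA P x ≤ valReal K hA P y ↔ valAt K hA P x ≤ valAt K hA P y := by
  rw [valAt_eq_coe K hA P hx, valAt_eq_coe K hA P hy, WithTop.coe_le_coe, valReal, valReal,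
    Rat.cast_le]

theorem valReal_add (P : MSpec (integralClosure A L)) {x y : L} (hx : x ≠ 0) (hy : y ≠ 0)
    (hxy : x + y ≠ 0) :
    valReal K hA P x ≤ valReal K hA P (x + y) ∨ valReal K hA P y ≤ valReal K hA P (x + y) := by
  rw [valReal_le_iff K hA P hx hxy, valReal_le_iff K hA P hy hxy]
  exact min_le_iff.1 ((valAt K hA P).map_add x y)

theorem mem_valuesOn_iff (P : MSpec (integralClosure A L)) (S : Set L) (r : ℝ) :
    r ∈ valuesOn K hA P S ↔ ∃ x ∈ S, x ≠ 0 ∧ valReal K hA P x = r := by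
  constructor
  · rintro ⟨x, hx, q, hq, rfl⟩
    have hx0 : x ≠ 0 := by
      rintro rfl
      rw [AddValuation.map_zero] at hq
      exact WithTop.top_ne_coe hq
    exact ⟨x, hx, hx0, (valReal_eq_iff K hA P hx0 q).2 hq⟩
  · rintro ⟨x, hx, hx0, rfl⟩
    exact ⟨x, hx, _, valAt_eq_coe K hA P hx0, rfl⟩

theorem valReal_nonneg_iff (P : MSpec (integralClosure A L)) {x : L} (hx : x ≠ 0) :
    0 ≤ valReal K hA P x ↔ ∃ a s : integralClosure A L, s ∉ P.ideal ∧ x * (s : L) = a := by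
  rw [← (valAt_spec K hA P).1 x, ← valReal_one K hA P, valReal_le_iff K hA P one_ne_zero hx,
    AddValuation.map_one]

theorem valReal_coe_nonneg (P : MSpec (integralClosure A L)) {a : integralClosure A L}
    (ha : a ≠ 0) : 0 ≤ valReal K hA P (a : L) :=
  (valReal_nonneg_iff K hA P (by simpa using ha)).2
    ⟨a, 1, fun h => P.isMaximal.ne_top ((Ideal.eq_top_iff_one _).2 h),
      by simp⟩

theorem valReal_coe_eq_zero (P : MSpec (integralClosure A L)) {a : integralClosure A L}
    (ha : a ∉ P.ideal) : valReal K hA P (a : L) = 0 := by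
  have ha0 : a ≠ 0 := fun h => ha (h ▸ P.ideal.zero_mem)
  have haL : (a : L) ≠ 0 := by simpa using ha0
  refine le_antisymm ?_ (valReal_coe_nonneg K hA P ha0)
  rw [← neg_nonneg, ← valReal_inv K hA P haL, valReal_nonneg_iff K hA P (inv_ne_zero haL)]
  exact ⟨1, a, ha, by simp [haL]⟩

/-- Otherwise `a⁻¹ = b / s` with `s ∉ P`, and `s = a * b` would lie in `P`. -/
theorem valReal_coe_pos (P : MSpec (integralClosure A L)) {a : integralClosure A L}
    (ha0 : a ≠ 0) (ha : a ∈ P.ideal) : 0 < valReal K hA P (a : L) := by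
  have haL : (a : L) ≠ 0 := by simpa using ha0
  by_contra h
  rw [not_lt, ← neg_nonneg, ← valReal_inv K hA P haL,
    valReal_nonneg_iff K hA P (inv_ne_zero haL)] at h
  obtain ⟨b, s, hs, h⟩ := h
  have : s = a * b := by
    apply Subtype.ext
    push_cast
    rw [← h, mul_inv_cancel_left₀ haL]
  exact hs (this ▸ P.ideal.mul_mem_right b ha)

theorem exists_valReal_algebraMap_eq (P : MSpec (integralClosure A L)) (n : ℤ) :
    ∃ k : K, k ≠ 0 ∧ valReal K hA P (algebraMap K L k) = n := by
  obtain ⟨k, hk, h⟩ : ((n : ℚ) : WithTop ℚ) ∈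
      {q : WithTop ℚ | ∃ a : K, a ≠ 0 ∧ valAt K hA P (algebraMap K L a) = q} :=
    (valAt_spec K hA P).2 ▸ ⟨n, rfl⟩
  refine ⟨k, hk, ?_⟩
  rw [(valReal_eq_iff K hA P (by simpa using hk) n).2 h, Rat.cast_intCast]

theorem exists_int_valReal_algebraMap (P : MSpec (integralClosure A L)) {k : K} (hk : k ≠ 0) :
    ∃ n : ℤ, valReal K hA P (algebraMap K L k) = n := by
  obtain ⟨n, h⟩ : valAt K hA P (algebraMap K L k) ∈
      Set.range (fun n : ℤ => ((n : ℚ) : WithTop ℚ)) :=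
    (valAt_spec K hA P).2 ▸ ⟨k, hk, rfl⟩
  refine ⟨n, ?_⟩
  rw [(valReal_eq_iff K hA P (by simpa using hk) n).2 h.symm, Rat.cast_intCast]

theorem exists_pow_valReal_eq (P : MSpec (integralClosure A L)) {x : L} (hx : x ≠ 0) :
    ∃ n : ℕ, 0 < n ∧ ∃ k : K, k ≠ 0 ∧
      valReal K hA P (x ^ n) = valReal K hA P (algebraMap K L k) := by
  -- The exponent is the denominator of the rational value of `x`; its numerator is a value on `K`
  -- by the normalization.
  let q : ℚ := (valAt K hA P x).untopD 0
  obtain ⟨k, hk, h⟩ := exists_valReal_algebraMap_eq K hA P q.num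
  refine ⟨q.den, q.den_pos, k, hk, ?_⟩
  rw [valReal_pow K hA P hx, h]
  show (q.den : ℝ) * (q : ℝ) = q.num
  exact_mod_cast Rat.den_mul_eq_num q

theorem one_le_valReal_algebraMap (P : MSpec (integralClosure A L)) {a : A} (ha0 : a ≠ 0)
    (ha : algebraMap A (integralClosure A L) a ∈ P.ideal) :
    1 ≤ valReal K hA P (algebraMap A L a) := by
  have haK : algebraMap A K a ≠ 0 := by
    simpa using ha0
  obtain ⟨n, hn⟩ := exists_int_valReal_algebraMap K hA P haK
  rw [← IsScalarTower.algebraMap_apply A K L] at hn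
  have haL : algebraMap A L a ≠ 0 := by
    rw [IsScalarTower.algebraMap_apply A K L]
    simpa using ha0
  have h0 := valReal_coe_pos K hA P (a := algebraMap A (integralClosure A L) a)
    (fun h => haL (congrArg Subtype.val h)) ha
  have h1 : 0 < valReal K hA P (algebraMap A L a) := h0
  rw [hn] at h1 ⊢
  exact_mod_cast Int.add_one_le_iff.2 (by exact_mod_cast h1 : (0 : ℤ) < n)

/-- Units for `p` have value `0` at `P`, so on `K` the valuation at `P` is a multiple of the
`p`-adic one. The factor is a non-negative integer dividing `1`, since the value `1` occurs. Hence
the values on `K` depend only on the prime below `P`. -/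
theorem valReal_algebraMap_eq (P : MSpec (integralClosure A L))
    (p : IsDedekindDomain.HeightOneSpectrum A)
    (hp : ∀ a, a ∈ p.asIdeal ↔ algebraMap A (integralClosure A L) a ∈ P.ideal)
    {k : K} (hk : k ≠ 0) :
    valReal K hA P (algebraMap K L k) = - ((p.valuation K k).log : ℝ) := by
  have inj : ∀ {k : K}, k ≠ 0 → algebraMap K L k ≠ 0 := fun hk => by simpa using hk
  have injA : ∀ {b : A}, b ≠ 0 → algebraMap A (integralClosure A L) b ≠ 0 := by
    intro b hb h
    have h' : algebraMap A L b = 0 := congrArg Subtype.val h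
    rw [IsScalarTower.algebraMap_apply A K L] at h'
    exact inj (by simpa using hb) h'
  have nonneg : ∀ k : K, k ≠ 0 → p.valuation K k ≤ 1 →
      0 ≤ valReal K hA P (algebraMap K L k) := by
    intro k hk h
    obtain ⟨b, d, h⟩ := p.exists_primeCompl_mul_eq_of_integer (K := K) k h
    refine (valReal_nonneg_iff K hA P (inj hk)).2 ⟨algebraMap A _ b, algebraMap A _ d,
      fun h => d.2 ((hp d).2 h), ?_⟩
    have := congrArg (algebraMap K L) h
    rw [map_mul, ← IsScalarTower.algebraMap_apply, ← IsScalarTower.algebraMap_apply] at this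
    exact this
  have unit : ∀ k : K, k ≠ 0 → p.valuation K k = 1 → valReal K hA P (algebraMap K L k) = 0 := by
    intro k hk h
    refine le_antisymm ?_ (nonneg k hk h.le)
    have := nonneg k⁻¹ (inv_ne_zero hk) (by rw [map_inv₀, h, inv_one])
    rw [map_inv₀, valReal_inv K hA P (inj hk)] at this
    linarith
  obtain ⟨π, hπ⟩ := p.valuation_exists_uniformizer K
  have hπ0 : π ≠ 0 := by
    rintro rfl
    rw [map_zero] at hπ
    exact absurd hπ.symm (by simp)
  have main : ∀ k : K, k ≠ 0 → valReal K hA P (algebraMap K L k) =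
      - ((p.valuation K k).log : ℝ) * valReal K hA P (algebraMap K L π) := by
    intro k hk
    have hpk : p.valuation K k ≠ 0 := by simpa using hk
    -- The multiplicative value of `π` is `exp (-1)`, so this power of `π` cancels that of `k`.
    have hone : p.valuation K (k * π ^ (p.valuation K k).log) = 1 := by
      rw [map_mul, map_zpow₀, hπ]
      nth_rw 1 [← WithZero.exp_log hpk]
      rw [← WithZero.exp_zsmul, ← WithZero.exp_add]
      simp
    have := unit _ (mul_ne_zero hk (zpow_ne_zero _ hπ0)) hone
    rw [map_mul, map_zpow₀, valReal_mul K hA P (inj hk) (zpow_ne_zero _ (inj hπ0)),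
      valReal_zpow K hA P (inj hπ0)] at this
    linarith
  obtain ⟨m, hm⟩ := exists_int_valReal_algebraMap K hA P hπ0
  have hm0 : 0 ≤ m := by
    have := nonneg π hπ0 (by rw [hπ]; decide)
    rw [hm] at this
    exact_mod_cast this
  obtain ⟨k₁, hk₁, h₁⟩ := exists_valReal_algebraMap_eq K hA P 1
  have hm1 : m = 1 := by
    rw [main k₁ hk₁, hm] at h₁
    have h2 : -(p.valuation K k₁).log * m = 1 := by exact_mod_cast h₁
    exact Int.eq_one_of_dvd_one hm0 ⟨_, by rw [← h2, mul_comm]⟩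
  rw [main k hk, hm, hm1]
  simp

theorem exists_heightOneSpectrum (hA : ¬ IsField A) (P : MSpec (integralClosure A L)) :
    ∃ p : IsDedekindDomain.HeightOneSpectrum A,
      ∀ a, a ∈ p.asIdeal ↔ algebraMap A (integralClosure A L) a ∈ P.ideal := by
  have hmax : (P.ideal.comap (algebraMap A (integralClosure A L))).IsMaximal :=
    Ideal.isMaximal_comap_of_isIntegral_of_isMaximal P.ideal
  exact ⟨⟨_, hmax.isPrime, Ring.ne_bot_of_isMaximal_of_not_isField hmax hA⟩, fun a => Iff.rfl⟩

theorem exists_ne_zero_algebraMap_mem (hA : ¬ IsField A) (P : MSpec (integralClosure A L)) :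
    ∃ a : A, a ≠ 0 ∧ algebraMap A (integralClosure A L) a ∈ P.ideal := by
  obtain ⟨p, hp⟩ := exists_heightOneSpectrum hA P
  obtain ⟨a, ha, ha0⟩ := Submodule.exists_mem_ne_zero_of_ne_bot p.ne_bot
  exact ⟨a, ha0, (hp a).1 ha⟩

/-- The prime `p` below `P` is finitely generated; the maximal ideals containing its generators form
a neighbourhood of `P`, and all of them lie over `p`. -/
theorem eventually_valReal_algebraMap_eq (P : MSpec (integralClosure A L)) {k : K} (hk : k ≠ 0) :
    ∀ᶠ Q in nhds P, valReal K hA Q (algebraMap K L k) = valReal K hA P (algebraMap K L k) := by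
  classical
  obtain ⟨p, hp⟩ := exists_heightOneSpectrum hA P
  obtain ⟨S, hS⟩ := (IsNoetherian.noetherian p.asIdeal : p.asIdeal.FG)
  have hSp : ∀ a ∈ S, a ∈ p.asIdeal := fun a ha => hS ▸ Ideal.subset_span ha
  refine Filter.mem_of_superset ((MSpec.isOpen_basicOpen
    (S.image (algebraMap A (integralClosure A L)))).mem_nhds fun b hb => ?_) fun Q hQ => ?_
  · obtain ⟨a, ha, rfl⟩ := Finset.mem_image.1 hb
    exact (hp a).1 (hSp a ha)
  · have hle : p.asIdeal ≤ Q.ideal.comap (algebraMap A (integralClosure A L)) := by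
      rw [← hS]
      exact Ideal.span_le.2 fun a ha => hQ _ (Finset.mem_image_of_mem _ ha)
    have heq := p.isMaximal.eq_of_le (Ideal.comap_ne_top _
      Q.isMaximal.ne_top) hle
    show valReal K hA Q (algebraMap K L k) = valReal K hA P (algebraMap K L k)
    rw [valReal_algebraMap_eq K hA P p hp hk, valReal_algebraMap_eq K hA Q p
      (fun a => by rw [heq, Ideal.mem_comap]) hk]

/-- The value of a fixed element is a locally constant function on the maximal spectrum. -/
theorem isLocallyConstant_valReal {x : L} (hx : x ≠ 0) :
    IsLocallyConstant fun P : MSpec (integralClosure A L) => valReal K hA P x := by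
  rw [IsLocallyConstant.iff_eventually_eq]
  intro P
  -- The quotient `x ^ n / k` has value `0` at `P`, so it is `b / s` with `b` and `s` outside `P`.
  -- Both stay outside `Q` for `Q` near `P`, where the value of `k` is also constant.
  obtain ⟨n, hn, k, hk, h⟩ := exists_pow_valReal_eq K hA P hx
  have hkL : algebraMap K L k ≠ 0 := by simpa using hk
  have hxn : x ^ n ≠ 0 := pow_ne_zero n hx
  have hy0 : x ^ n / algebraMap K L k ≠ 0 := div_ne_zero hxn hkL
  have hy : valReal K hA P (x ^ n / algebraMap K L k) = 0 := by
    rw [valReal_div K hA P hxn hkL, h, sub_self]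
  obtain ⟨b, s, hs, hbs⟩ := (valReal_nonneg_iff K hA P hy0).1 hy.ge
  have hs0 : s ≠ 0 := fun h => hs (h ▸ P.ideal.zero_mem)
  have hsL : (s : L) ≠ 0 := by simpa using hs0
  have hb0 : b ≠ 0 := by
    rintro rfl
    exact mul_ne_zero hy0 hsL hbs
  have key : ∀ Q : MSpec (integralClosure A L), s ∉ Q.ideal →
      valReal K hA Q (x ^ n / algebraMap K L k) = valReal K hA Q (b : L) := by
    intro Q hsQ
    rw [← hbs, valReal_mul K hA Q hy0 hsL, valReal_coe_eq_zero K hA Q hsQ, add_zero]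
  have hb : b ∉ P.ideal := fun hbP => by
    have := valReal_coe_pos K hA P hb0 hbP
    rw [← key P hs, hy] at this
    exact lt_irrefl _ this
  filter_upwards [eventually_valReal_algebraMap_eq K hA P hk,
    (MSpec.isOpen_setOf_notMem s).mem_nhds hs, (MSpec.isOpen_setOf_notMem b).mem_nhds hb]
    with Q h1 h2 h3
  have h4 := key Q h2
  rw [valReal_coe_eq_zero K hA Q h3, valReal_div K hA Q hxn hkL, h1, ← h,
    valReal_pow K hA Q hx, valReal_pow K hA P hx] at h4
  have hn' : (n : ℝ) ≠ 0 := by exact_mod_cast hn.ne'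
  exact mul_left_cancel₀ hn' (by linarith)

end values

/-! ### Cuts of sets of real numbers -/

namespace RTilde

open Classical in
/-- The infimum of a set of real numbers, together with the information whether it is attained. -/
noncomputable def cut (S : Set ℝ) : RTilde where
  fst := sInf S
  snd := if sInf S ∈ S then 0 else 1

theorem lt_mk_zero_iff (a : RTilde) (r : ℝ) : a < ⟨r, 0⟩ ↔ a.fst < r := by
  simp [lt_iff]

theorem mk_zero_le_iff (a : RTilde) (r : ℝ) : ⟨r, 0⟩ ≤ a ↔ r ≤ a.fst := by
  rw [← not_lt, lt_mk_zero_iff, not_lt]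

/-- `(r, 1)` is the immediate successor of `(r, 0)`, so strict bounds by the former are weak bounds
by the latter. -/
theorem lt_mk_one_iff (a : RTilde) (r : ℝ) : a < ⟨r, 1⟩ ↔ a ≤ ⟨r, 0⟩ := by
  rw [lt_iff, le_iff]
  have : ∀ s : Fin 2, s < 1 ↔ s ≤ 0 := by decide
  simp only [this]

theorem mk_zero_le_mk_zero_iff (r s : ℝ) : (⟨r, 0⟩ : RTilde) ≤ ⟨s, 0⟩ ↔ r ≤ s :=
  mk_zero_le_iff _ _

theorem le_mk_zero_of_snd_eq_zero {a : RTilde} (ha : a.snd = 0) (r : ℝ) :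
    a ≤ ⟨r, 0⟩ ↔ a.fst ≤ r := by
  rw [le_iff, ha]
  simpa using _root_.le_iff_lt_or_eq.symm

theorem le_mk_zero_of_snd_eq_one {a : RTilde} (ha : a.snd = 1) (r : ℝ) :
    a ≤ ⟨r, 0⟩ ↔ a.fst < r := by
  simp [le_iff, ha]

theorem snd_eq_zero_or_one (a : RTilde) : a.snd = 0 ∨ a.snd = 1 := by
  have : ∀ s : Fin 2, s = 0 ∨ s = 1 := by decide
  exact this _

theorem iota_fst (a : RTilde) : (iota a).fst = - a.fst := rfl

theorem iota_snd (a : RTilde) : (iota a).snd = a.snd := rfl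

theorem cut_lt_mk_zero_iff {S : Set ℝ} (hS : S.Nonempty) (hS' : BddBelow S) (r : ℝ) :
    cut S < ⟨r, 0⟩ ↔ ∃ s ∈ S, s < r := by
  rw [lt_mk_zero_iff]
  exact csInf_lt_iff hS' hS

/-- This is the purpose of the second coordinate: an infimum `r` that is not attained gives `(r,
1)`, which exceeds `(r, 0)`. -/
theorem cut_le_mk_zero_iff {S : Set ℝ} (hS : S.Nonempty) (hS' : BddBelow S) (r : ℝ) :
    cut S ≤ ⟨r, 0⟩ ↔ ∃ s ∈ S, s ≤ r := by
  by_cases h : sInf S ∈ S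
  · rw [le_mk_zero_of_snd_eq_zero (by simp [cut, h])]
    exact ⟨fun hr => ⟨_, h, hr⟩, fun ⟨s, hs, hr⟩ => (csInf_le hS' hs).trans hr⟩
  · rw [le_mk_zero_of_snd_eq_one (by simp [cut, h])]
    refine ⟨fun hr => ?_, fun ⟨s, hs, hr⟩ => ?_⟩
    · obtain ⟨s, hs, hr⟩ := (csInf_lt_iff hS' hS).1 hr
      exact ⟨s, hs, hr.le⟩
    · have hlt : sInf S < s := lt_of_le_of_ne (csInf_le hS' hs) fun he => h (he ▸ hs)
      exact lt_of_lt_of_le hlt hr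

/-- The infimum of `U` is attained only if both others are, since `s + t ≤ inf S + inf T` forces
equality in each summand. An inequality in `h₂` is enough, and it is all that the ultrametric
inequality provides for sums of products. -/
theorem cut_add {S T U : Set ℝ} (hS : S.Nonempty) (hS' : BddBelow S) (hT : T.Nonempty)
    (hT' : BddBelow T) (h₁ : ∀ s ∈ S, ∀ t ∈ T, s + t ∈ U)
    (h₂ : ∀ u ∈ U, ∃ s ∈ S, ∃ t ∈ T, s + t ≤ u) : cut U = cut S + cut T := by
  have hU : U.Nonempty := by
    obtain ⟨s, hs⟩ := hS
    obtain ⟨t, ht⟩ := hT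
    exact ⟨_, h₁ s hs t ht⟩
  have hle : ∀ u ∈ U, sInf S + sInf T ≤ u := by
    intro u hu
    obtain ⟨s, hs, t, ht, h⟩ := h₂ u hu
    exact (add_le_add (csInf_le hS' hs) (csInf_le hT' ht)).trans h
  have hinf : sInf U = sInf S + sInf T := by
    refine le_antisymm ?_ (le_csInf hU hle)
    have hU' : BddBelow U := ⟨_, hle⟩
    have h1 : ∀ s ∈ S, sInf U - sInf T ≤ s := by
      intro s hs
      have : sInf U - s ≤ sInf T := le_csInf hT fun t ht => by
        have := csInf_le hU' (h₁ s hs t ht)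
        linarith
      linarith
    have := le_csInf hS h1
    linarith
  have hmem : sInf U ∈ U ↔ sInf S ∈ S ∧ sInf T ∈ T := by
    constructor
    · intro hu
      obtain ⟨s, hs, t, ht, h⟩ := h₂ _ hu
      rw [hinf] at h
      have h1 := csInf_le hS' hs
      have h2 := csInf_le hT' ht
      have e1 : s = sInf S := by linarith
      have e2 : t = sInf T := by linarith
      exact ⟨e1 ▸ hs, e2 ▸ ht⟩
    · rintro ⟨h1, h2⟩
      rw [hinf]
      exact h₁ _ h1 _ h2
  refine RTilde.ext hinf ?_
  by_cases h1 : sInf S ∈ S <;> by_cases h2 : sInf T ∈ T <;> simp [cut, hmem, h1, h2]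

theorem cut_eq_of_snd_eq_zero {S : Set ℝ} {a : RTilde} (ha : a.snd = 0) (hmem : a.fst ∈ S)
    (hle : ∀ s ∈ S, a.fst ≤ s) : cut S = a := by
  have : sInf S = a.fst := (IsLeast.csInf_eq ⟨hmem, hle⟩)
  exact RTilde.ext this (by simp [cut, this, hmem, ha])

theorem cut_eq_of_snd_eq_one {S : Set ℝ} {a : RTilde} (ha : a.snd = 1)
    (hlt : ∀ s ∈ S, a.fst < s) (hex : ∀ r, a.fst < r → ∃ s ∈ S, s < r) : cut S = a := by
  have hS : S.Nonempty := (hex (a.fst + 1) (by linarith)).imp fun _ h => h.1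
  have : sInf S = a.fst := csInf_eq_of_forall_ge_of_forall_gt_exists_lt hS
    (fun s hs => (hlt s hs).le) hex
  refine RTilde.ext this ?_
  have hn : a.fst ∉ S := fun h => lt_irrefl _ (hlt _ h)
  simp [cut, this, hn, ha]

end RTilde

/-! ### The function of a fractional ideal -/

theorem MSpec.exists_le_ideal {R : Type*} [CommRing R] {D : Ideal R} (hD : D ≠ ⊤) :
    ∃ P : MSpec R, D ≤ P.ideal := by
  obtain ⟨M, hM, hle⟩ := Ideal.exists_le_maximal D hD
  exact ⟨(⟨M, hM⟩ : MaximalSpectrum R), hle⟩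

theorem FractionalIdeal.exists_mem_ne_zero {R L : Type*} [CommRing R] [Field L] [Algebra R L]
    {I : FractionalIdeal (nonZeroDivisors R) L} (hI : I ≠ 0) : ∃ x ∈ I, x ≠ 0 := by
  by_contra! h
  exact hI (FractionalIdeal.eq_zero_iff.2 h)

theorem FractionalIdeal.exists_denominator {R L : Type*} [CommRing R] [Nontrivial R]
    [Field L] [Algebra R L]
    (I : FractionalIdeal (nonZeroDivisors R) L) : ∃ d : R, d ≠ 0 ∧
    ∀ x ∈ I, ∃ b : R, algebraMap R L d * x = algebraMap R L b := by
  obtain ⟨d, hd, h⟩ := I.isFractional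
  refine ⟨d, nonZeroDivisors.ne_zero hd, fun x hx => ?_⟩
  obtain ⟨b, hb⟩ := h x hx
  exact ⟨b, by rw [hb, Algebra.smul_def]⟩

theorem exists_coe_div_coe_eq {A : Type*} (K : Type*) {L : Type*} [CommRing A]
    [IsDomain A] [Field K] [Algebra A K] [IsFractionRing A K] [Field L] [Algebra K L]
    [Algebra A L] [IsScalarTower A K L] [Algebra.IsAlgebraic K L] (x : L) :
    ∃ a s : integralClosure A L, s ≠ 0 ∧ x * (s : L) = a := by
  have hx : IsAlgebraic A x := (IsFractionRing.isAlgebraic_iff A K L).2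
    (Algebra.IsAlgebraic.isAlgebraic x)
  obtain ⟨y, hy, h⟩ := hx.exists_integral_multiple
  refine ⟨⟨_, h⟩, algebraMap A _ y, fun h0 => hy ?_, ?_⟩
  · have h' : algebraMap A L y = 0 := congrArg Subtype.val h0
    rw [IsScalarTower.algebraMap_apply A K L] at h'
    simpa using h'
  · show x * algebraMap A L y = y • x
    rw [Algebra.smul_def, mul_comm]

section values

variable {A : Type*} (K : Type*) {L : Type*} [CommRing A] [IsDedekindDomain A]
  (hA : ¬ IsField A) [Field K] [Algebra A K] [IsFractionRing A K] [Field L] [Algebra K L]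
  [Algebra A L] [IsScalarTower A K L] [Algebra.IsAlgebraic K L]

theorem idealFun_eq_cut (I : FractionalIdeal (nonZeroDivisors (integralClosure A L)) L)
    (P : MSpec (integralClosure A L)) :
    idealFun K hA I P = RTilde.cut (valuesOn K hA P {x | x ∈ I}) := by
  rw [idealFun, RTilde.cut]

/-- The value of a fixed element is a function with compact support. -/
theorem exists_isCompact_valReal_eq_zero {x : L} (hx : x ≠ 0) :
    ∃ Y : Set (MSpec (integralClosure A L)), IsCompact Y ∧
      ∀ P, P ∉ Y → valReal K hA P x = 0 := by
  obtain ⟨a, s, hs, h⟩ := exists_coe_div_coe_eq (A := A) K x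
  have hsL : (s : L) ≠ 0 := by simpa using hs
  have ha : a ≠ 0 := by
    rintro rfl
    exact mul_ne_zero hx hsL h
  -- Since `x = a / s`, its value vanishes wherever `a` and `s` are both units.
  refine ⟨MSpec.basicOpen {a} ∪ MSpec.basicOpen {s},
    (MSpec.isCompact_basicOpen_singleton ha).union (MSpec.isCompact_basicOpen_singleton hs),
    fun P hP => ?_⟩
  have h1 := valReal_coe_eq_zero K hA P fun h =>
    hP (Or.inl (MSpec.mem_basicOpen_singleton.2 h))
  rwa [← h, valReal_mul K hA P hx hsL, valReal_coe_eq_zero K hA P fun h =>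
    hP (Or.inr (MSpec.mem_basicOpen_singleton.2 h)), add_zero] at h1

theorem exists_abs_valReal_le {x : L} (hx : x ≠ 0) :
    ∃ C : ℝ, ∀ P : MSpec (integralClosure A L), |valReal K hA P x| ≤ C := by
  obtain ⟨Y, hY, h⟩ := exists_isCompact_valReal_eq_zero K hA hx
  obtain ⟨C, hC⟩ := hY.exists_bound_of_continuousOn
    (isLocallyConstant_valReal K hA hx).continuous.continuousOn
  refine ⟨max C 0, fun P => ?_⟩
  by_cases hP : P ∈ Y
  · exact (hC P hP).trans (le_max_left _ _)
  · rw [h P hP, abs_zero]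
    exact le_max_right _ _

/-- An element that is integral at every maximal ideal is integral. -/
theorem mem_integralClosure_of_valReal_nonneg {x : L} (hx : x ≠ 0)
    (h : ∀ P : MSpec (integralClosure A L), 0 ≤ valReal K hA P x) :
    x ∈ integralClosure A L := by
  -- `D` is the ideal of denominators of `x`. For each `Q` it contains some `s ∉ Q`, so it lies in
  -- no maximal ideal.
  let D : Ideal (integralClosure A L) :=
    { carrier := {s | x * (s : L) ∈ integralClosure A L}
      zero_mem' := by simp
      add_mem' := fun {s t} hs ht => by
        simp only [Set.mem_ofPred_eq, Subalgebra.coe_add, mul_add] at hs ht ⊢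
        exact add_mem hs ht
      smul_mem' := fun c s hs => by
        simp only [Set.mem_ofPred_eq, smul_eq_mul, Subalgebra.coe_mul] at hs ⊢
        rw [mul_left_comm]
        exact mul_mem c.2 hs }
  have hD : D = ⊤ := by
    by_contra hne
    obtain ⟨Q, hle⟩ := MSpec.exists_le_ideal hne
    obtain ⟨a, s, hs, has⟩ := (valReal_nonneg_iff K hA Q hx).1 (h Q)
    exact hs (hle (show x * (s : L) ∈ integralClosure A L by rw [has]; exact a.2))
  have : x * ((1 : integralClosure A L) : L) ∈ integralClosure A L :=
    (Ideal.eq_top_iff_one D).1 hD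
  simpa using this

variable {I J : FractionalIdeal (nonZeroDivisors (integralClosure A L)) L}

variable (I) in
theorem exists_neg_valReal_le : ∃ d : integralClosure A L, d ≠ 0 ∧
    ∀ x ∈ I, x ≠ 0 → ∀ P, - valReal K hA P (d : L) ≤ valReal K hA P x := by
  obtain ⟨d, hd, h⟩ := FractionalIdeal.exists_denominator I
  refine ⟨d, hd, fun x hx hx0 P => ?_⟩
  obtain ⟨b, hb⟩ := h x hx
  change (d : L) * x = b at hb
  have hdL : (d : L) ≠ 0 := by simpa using hd
  have hb0 : b ≠ 0 := by
    rintro rfl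
    exact mul_ne_zero hdL hx0 hb
  have := valReal_coe_nonneg K hA P hb0
  rw [← hb, valReal_mul K hA P hdL hx0] at this
  linarith

variable (P : MSpec (integralClosure A L))

theorem valuesOn_nonempty (hI : I ≠ 0) : (valuesOn K hA P {x | x ∈ I}).Nonempty := by
  obtain ⟨x, hx, hx0⟩ := FractionalIdeal.exists_mem_ne_zero hI
  exact ⟨_, (mem_valuesOn_iff K hA P _ _).2 ⟨x, hx, hx0, rfl⟩⟩

variable (I) in
theorem bddBelow_valuesOn : BddBelow (valuesOn K hA P {x | x ∈ I}) := by
  obtain ⟨d, -, h⟩ := exists_neg_valReal_le K hA I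
  refine ⟨- valReal K hA P (d : L), fun r hr => ?_⟩
  obtain ⟨x, hx, hx0, rfl⟩ := (mem_valuesOn_iff K hA P _ _).1 hr
  exact h x hx hx0 P

theorem idealFun_le_iff (hI : I ≠ 0) (r : ℝ) :
    idealFun K hA I P ≤ ⟨r, 0⟩ ↔ ∃ x ∈ I, x ≠ 0 ∧ valReal K hA P x ≤ r := by
  rw [idealFun_eq_cut, RTilde.cut_le_mk_zero_iff (valuesOn_nonempty K hA P hI)
    (bddBelow_valuesOn K hA I P)]
  simp only [mem_valuesOn_iff]
  exact ⟨fun ⟨_, ⟨x, hx, hx0, rfl⟩, h⟩ => ⟨x, hx, hx0, h⟩,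
    fun ⟨x, hx, hx0, h⟩ => ⟨_, ⟨x, hx, hx0, rfl⟩, h⟩⟩

theorem idealFun_lt_iff (hI : I ≠ 0) (r : ℝ) :
    idealFun K hA I P < ⟨r, 0⟩ ↔ ∃ x ∈ I, x ≠ 0 ∧ valReal K hA P x < r := by
  rw [idealFun_eq_cut, RTilde.cut_lt_mk_zero_iff (valuesOn_nonempty K hA P hI)
    (bddBelow_valuesOn K hA I P)]
  simp only [mem_valuesOn_iff]
  exact ⟨fun ⟨_, ⟨x, hx, hx0, rfl⟩, h⟩ => ⟨x, hx, hx0, h⟩,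
    fun ⟨x, hx, hx0, h⟩ => ⟨_, ⟨x, hx, hx0, rfl⟩, h⟩⟩

/-- Consider the ideal of all `s` with `s * x ∈ I`. At each `Q` some `y ∈ I` has value at most that
of `x`, so `x / y = a / s` with `s ∉ Q` and `s * x = a * y ∈ I`. Hence this ideal is contained in no
`Q`. -/
theorem mem_iff_forall_idealFun_le (hI : I ≠ 0) {x : L} (hx : x ≠ 0) :
    x ∈ I ↔ ∀ P, idealFun K hA I P ≤ ⟨valReal K hA P x, 0⟩ := by
  refine ⟨fun h P => (idealFun_le_iff K hA P hI _).2 ⟨x, h, hx, le_rfl⟩, fun h => ?_⟩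
  let D : Ideal (integralClosure A L) :=
    { carrier := {s | (s : L) * x ∈ I}
      zero_mem' := by simpa using I.zero_mem
      add_mem' := fun {s t} hs ht => by
        simp only [Set.mem_ofPred_eq, Subalgebra.coe_add, add_mul] at hs ht ⊢
        exact (I : Submodule (integralClosure A L) L).add_mem hs ht
      smul_mem' := fun c s hs => by
        simp only [Set.mem_ofPred_eq, smul_eq_mul, Subalgebra.coe_mul, mul_assoc] at hs ⊢
        exact (I : Submodule (integralClosure A L) L).smul_mem c hs }
  have hD : D = ⊤ := by
    by_contra hne
    obtain ⟨Q, hle⟩ := MSpec.exists_le_ideal hne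
    obtain ⟨y, hy, hy0, hyx⟩ := (idealFun_le_iff K hA Q hI _).1 (h Q)
    obtain ⟨a, s, hs, has⟩ := (valReal_nonneg_iff K hA Q (div_ne_zero hx hy0)).1 (by
      rw [valReal_div K hA _ hx hy0, sub_nonneg]
      exact hyx)
    refine hs (hle (show (s : L) * x ∈ I from ?_))
    have : (s : L) * x = a • y := by
      rw [Algebra.smul_def]
      show (s : L) * x = (a : L) * y
      rw [← has]
      field_simp
    rw [this]
    exact (I : Submodule (integralClosure A L) L).smul_mem a hy
  have : ((1 : integralClosure A L) : L) * x ∈ I := (Ideal.eq_top_iff_one D).1 hD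
  simpa using this

theorem eq_of_idealFun_eq (hI : I ≠ 0) (hJ : J ≠ 0) (h : idealFun K hA I = idealFun K hA J) :
    I = J := by
  ext x
  by_cases hx : x = 0
  · simp [hx, I.zero_mem, J.zero_mem]
  · rw [mem_iff_forall_idealFun_le K hA hI hx, mem_iff_forall_idealFun_le K hA hJ hx, h]

theorem idealFun_mul (hI : I ≠ 0) (hJ : J ≠ 0) :
    idealFun K hA (I * J) P = idealFun K hA I P + idealFun K hA J P := by
  simp only [idealFun_eq_cut]
  refine RTilde.cut_add (valuesOn_nonempty K hA P hI) (bddBelow_valuesOn K hA I P)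
    (valuesOn_nonempty K hA P hJ) (bddBelow_valuesOn K hA J P) ?_ ?_
  · intro r hr s hs
    obtain ⟨x, hx, hx0, rfl⟩ := (mem_valuesOn_iff K hA P _ _).1 hr
    obtain ⟨y, hy, hy0, rfl⟩ := (mem_valuesOn_iff K hA P _ _).1 hs
    exact (mem_valuesOn_iff K hA P _ _).2 ⟨x * y, FractionalIdeal.mul_mem_mul hx hy,
      mul_ne_zero hx0 hy0, valReal_mul K hA P hx0 hy0⟩
  · intro u hu
    obtain ⟨z, hz, hz0, rfl⟩ := (mem_valuesOn_iff K hA P _ _).1 hu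
    -- The condition `z ≠ 0` stays inside the induction predicate because partial sums of products
    -- may vanish.
    have key : z ≠ 0 → ∃ x ∈ I, x ≠ 0 ∧ ∃ y ∈ J, y ≠ 0 ∧
        valReal K hA P x + valReal K hA P y ≤ valReal K hA P z := by
      refine FractionalIdeal.mul_induction_on (C := fun z => z ≠ 0 → ∃ x ∈ I, x ≠ 0 ∧ ∃ y ∈ J,
        y ≠ 0 ∧ valReal K hA P x + valReal K hA P y ≤ valReal K hA P z) hz ?_ ?_
      · intro x hx y hy hxy
        have hx0 := left_ne_zero_of_mul hxy
        have hy0 := right_ne_zero_of_mul hxy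
        exact ⟨x, hx, hx0, y, hy, hy0, (valReal_mul K hA P hx0 hy0).ge⟩
      · intro z w ihz ihw hzw
        by_cases hz : z = 0
        · rw [hz, zero_add] at hzw ⊢
          exact ihw hzw
        by_cases hw : w = 0
        · rw [hw, add_zero] at hzw ⊢
          exact ihz hzw
        rcases valReal_add K hA P hz hw hzw with h | h
        · obtain ⟨x, hx, hx0, y, hy, hy0, h'⟩ := ihz hz
          exact ⟨x, hx, hx0, y, hy, hy0, h'.trans h⟩
        · obtain ⟨x, hx, hx0, y, hy, hy0, h'⟩ := ihw hw
          exact ⟨x, hx, hx0, y, hy, hy0, h'.trans h⟩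
    obtain ⟨x, hx, hx0, y, hy, hy0, h⟩ := key hz0
    exact ⟨_, (mem_valuesOn_iff K hA P _ _).2 ⟨x, hx, hx0, rfl⟩,
      _, (mem_valuesOn_iff K hA P _ _).2 ⟨y, hy, hy0, rfl⟩, h⟩

/-- A strict upper bound at `P` is witnessed by one element of `I`; as its value is locally
constant, it witnesses the same bound nearby. -/
theorem upperSemicontinuous_idealFun (hI : I ≠ 0) : UpperSemicontinuous (idealFun K hA I) := by
  rintro P ⟨r, s⟩ h
  have loc : ∀ x : L, x ≠ 0 → ∀ᶠ Q in nhds P, valReal K hA Q x = valReal K hA P x := fun x hx =>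
    (IsLocallyConstant.iff_eventually_eq _).1 (isLocallyConstant_valReal K hA hx) P
  rcases RTilde.snd_eq_zero_or_one ⟨r, s⟩ with hs | hs <;> obtain rfl : s = _ := hs
  · obtain ⟨x, hx, hx0, hlt⟩ := (idealFun_lt_iff K hA P hI r).1 h
    filter_upwards [loc x hx0] with Q hQ
    exact (idealFun_lt_iff K hA Q hI r).2 ⟨x, hx, hx0, by rwa [hQ]⟩
  · rw [RTilde.lt_mk_one_iff] at h
    obtain ⟨x, hx, hx0, hle⟩ := (idealFun_le_iff K hA P hI r).1 h
    filter_upwards [loc x hx0] with Q hQ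
    rw [RTilde.lt_mk_one_iff]
    exact (idealFun_le_iff K hA Q hI r).2 ⟨x, hx, hx0, by rwa [hQ]⟩

/-- The function lies between `-v(d)`, for a common denominator `d`, and `v(x)`, for some `x ∈ I`.
Both are bounded, and outside the union of their compact supports they squeeze it to `(0, 0)`. -/
theorem idealFun_mem_suZeroB (hI : I ≠ 0) : idealFun K hA I ∈
    suZeroB (MSpec (integralClosure A L)) := by
  obtain ⟨x, hx, hx0⟩ := FractionalIdeal.exists_mem_ne_zero hI
  obtain ⟨d, hd0, hd⟩ := exists_neg_valReal_le K hA I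
  have hdL : (d : L) ≠ 0 := by simpa using hd0
  have hlow : ∀ P, ⟨- valReal K hA P (d : L), 0⟩ ≤ idealFun K hA I P := by
    intro P
    rw [← not_lt, idealFun_lt_iff K hA P hI]
    rintro ⟨y, hy, hy0, h⟩
    exact absurd h (not_lt.2 (hd y hy hy0 P))
  have hup : ∀ P, idealFun K hA I P ≤ ⟨valReal K hA P x, 0⟩ :=
    (mem_iff_forall_idealFun_le K hA hI hx0).1 hx
  obtain ⟨C, hC⟩ := exists_abs_valReal_le (A := A) K hA hx0
  obtain ⟨D, hD⟩ := exists_abs_valReal_le (A := A) K hA hdL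
  obtain ⟨Y, hY, hYx⟩ := exists_isCompact_valReal_eq_zero (A := A) K hA hx0
  obtain ⟨Z, hZ, hZd⟩ := exists_isCompact_valReal_eq_zero (A := A) K hA hdL
  refine ⟨upperSemicontinuous_idealFun K hA hI, ⟨⟨⟨C, 0⟩, ?_⟩, ⟨⟨-D, 0⟩, ?_⟩⟩, Y ∪ Z, hY.union hZ,
    fun P hP => ?_⟩
  · rintro _ ⟨P, rfl⟩
    exact (hup P).trans ((RTilde.mk_zero_le_mk_zero_iff _ _).2 (abs_le.1 (hC P)).2)
  · rintro _ ⟨P, rfl⟩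
    exact ((RTilde.mk_zero_le_mk_zero_iff _ _).2 (neg_le_neg (abs_le.1 (hD P)).2)).trans (hlow P)
  · have h1 := hup P
    have h2 := hlow P
    rw [hYx P fun h => hP (Or.inl h)] at h1
    rw [hZd P fun h => hP (Or.inr h), neg_zero] at h2
    exact le_antisymm h1 h2

/-- The value group of the valuation at `P`. -/
noncomputable def valueGroup : AddSubgroup ℝ where
  carrier := valuesOn K hA P Set.univ
  zero_mem' := valuesOn_univ_zero K hA P
  add_mem' := valuesOn_univ_add K hA P
  neg_mem' := by
    intro r hr
    obtain ⟨x, -, hx0, rfl⟩ := (mem_valuesOn_iff K hA P _ _).1 hr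
    exact (mem_valuesOn_iff K hA P _ _).2
      ⟨x⁻¹, trivial, inv_ne_zero hx0, valReal_inv K hA P hx0⟩

theorem valuesOn_subset_valueGroup (S : Set L) :
    valuesOn K hA P S ⊆ valueGroup K hA P :=
  fun _ ⟨x, _, h⟩ => ⟨x, trivial, h⟩

/-- If the infimum is not attained, two distinct values lie within `ε` of it; their difference is a
positive element of the value group below `ε`, so the group is dense. -/
theorem idealFun_mem_valTilde (hI : I ≠ 0) : idealFun K hA I P ∈ valTilde K hA P := by
  let S := valuesOn K hA P {x | x ∈ I}
  have hS : S.Nonempty := valuesOn_nonempty K hA P hI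
  have hS' : BddBelow S := bddBelow_valuesOn K hA I P
  have hSG : S ⊆ valueGroup K hA P := valuesOn_subset_valueGroup K hA P _
  rw [idealFun_eq_cut]
  by_cases h : sInf S ∈ S
  · exact Or.inl ⟨hSG h, if_pos h⟩
  · refine Or.inr ⟨?_, if_neg h⟩
    have hlt : ∀ s ∈ S, sInf S < s := fun s hs =>
      lt_of_le_of_ne (csInf_le hS' hs) fun he => h (by rwa [he])
    refine dense_iff_closure_eq.1 (AddSubgroup.dense_of_not_isolated_zero (valueGroup K hA P) ?_)
    intro ε hε
    obtain ⟨s, hs, hsε⟩ := exists_lt_of_csInf_lt hS (lt_add_of_pos_right (sInf S) hε)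
    obtain ⟨t, ht, hts⟩ := exists_lt_of_csInf_lt hS (hlt s hs)
    have := hlt t ht
    exact ⟨s - t, sub_mem (hSG hs) (hSG ht), by linarith, by linarith⟩

end values

/-! ### The fractional ideal of a function -/

/-- An element of `S` that works at `Q` works on a neighbourhood of `Q`; the product over a finite
subcover works everywhere. -/
theorem MSpec.exists_mem_of_isCompact {R : Type*} [CommRing R] (S : Submonoid R)
    {Y : Set (MSpec R)} (hY : IsCompact Y) (h : ∀ Q ∈ Y, ∃ b ∈ S, b ∈ Q.ideal) :
    ∃ b ∈ S, ∀ Q ∈ Y, b ∈ Q.ideal := by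
  refine hY.induction_on (p := fun Z => ∃ b ∈ S, ∀ Q ∈ Z, b ∈ Q.ideal) ⟨1, S.one_mem, by simp⟩
    ?_ ?_ ?_
  · rintro Z Z' hZ ⟨b, hb, h⟩
    exact ⟨b, hb, fun Q hQ => h Q (hZ hQ)⟩
  · rintro Z Z' ⟨b, hb, h⟩ ⟨c, hc, h'⟩
    refine ⟨b * c, S.mul_mem hb hc, ?_⟩
    rintro Q (hQ | hQ)
    · exact Q.ideal.mul_mem_right c (h Q hQ)
    · exact Q.ideal.mul_mem_left b (h' Q hQ)
  · intro Q hQ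
    obtain ⟨b, hb, hbQ⟩ := h Q hQ
    exact ⟨_, mem_nhdsWithin_of_mem_nhds ((isOpen_basicOpen {b}).mem_nhds
      (mem_basicOpen_singleton.2 hbQ)), b, hb, fun Q' hQ' => mem_basicOpen_singleton.1 hQ'⟩

section values

variable {A : Type*} (K : Type*) {L : Type*} [CommRing A] [IsDedekindDomain A]
  (hA : ¬ IsField A) [Field K] [Algebra A K] [IsFractionRing A K] [Field L] [Algebra K L]
  [Algebra A L] [IsScalarTower A K L] [Algebra.IsAlgebraic K L]

theorem exists_ne_zero_algebraMap_mem_of_isCompact (hA : ¬ IsField A)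
    {Y : Set (MSpec (integralClosure A L))} (hY : IsCompact Y) :
    ∃ a : A, a ≠ 0 ∧ ∀ Q ∈ Y, algebraMap A (integralClosure A L) a ∈ Q.ideal := by
  obtain ⟨_, ⟨a, ha, rfl⟩, h⟩ := MSpec.exists_mem_of_isCompact
    ((nonZeroDivisors A).map (algebraMap A (integralClosure A L))) hY fun Q _ => by
      obtain ⟨a, ha, h⟩ := exists_ne_zero_algebraMap_mem hA Q
      exact ⟨_, ⟨a, mem_nonZeroDivisors_of_ne_zero ha, rfl⟩, h⟩
  exact ⟨a, nonZeroDivisors.ne_zero ha, h⟩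

/-- Elements with large values on a compact set that are units at a given point outside it. -/
theorem exists_notMem_forall_le_valReal {P : MSpec (integralClosure A L)}
    {Y : Set (MSpec (integralClosure A L))} (hY : IsCompact Y) (hP : P ∉ Y) (C : ℝ) :
    ∃ t : integralClosure A L, t ∉ P.ideal ∧ ∀ Q ∈ Y, C ≤ valReal K hA Q (t : L) := by
  -- Each `Q ∈ Y` differs from `P`, so it contains an element outside `P`.
  obtain ⟨t, ht, htY⟩ := MSpec.exists_mem_of_isCompact P.ideal.primeCompl hY fun Q hQ => by
    by_contra! h
    have hle : Q.ideal ≤ P.ideal := fun b hb => by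
      by_contra hbP
      exact h b hbP hb
    exact hP (MSpec.eq_of_le hle ▸ hQ)
  rcases Y.eq_empty_or_nonempty with rfl | hne
  · exact ⟨t, ht, by simp⟩
  have ht0 : t ≠ 0 := fun h => ht (h ▸ P.ideal.zero_mem)
  have htL : (t : L) ≠ 0 := by simpa using ht0
  -- The continuous value of `t` has a positive minimum on `Y`, so a large power of `t` exceeds `C`
  -- there.
  obtain ⟨Q₀, hQ₀, hmin⟩ := hY.exists_isMinOn hne
    (isLocallyConstant_valReal K hA htL).continuous.continuousOn
  have hpos : 0 < valReal K hA Q₀ (t : L) := valReal_coe_pos K hA Q₀ ht0 (htY Q₀ hQ₀)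
  obtain ⟨n, hn⟩ := exists_nat_ge (C / valReal K hA Q₀ (t : L))
  refine ⟨t ^ n, fun h => ht (P.isMaximal.isPrime.mem_of_pow_mem n h), fun Q hQ => ?_⟩
  rw [Subalgebra.coe_pow, valReal_pow K hA Q htL]
  calc C ≤ n * valReal K hA Q₀ (t : L) := (div_le_iff₀ hpos).1 hn
    _ ≤ n * valReal K hA Q (t : L) := mul_le_mul_of_nonneg_left (hmin hQ) (Nat.cast_nonneg n)

variable {f : MSpec (integralClosure A L) → RTilde}

theorem exists_forall_le_mk_zero {X : Type*} [TopologicalSpace X] {f : X → RTilde}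
    (hf : f ∈ suZeroB X) : ∃ N : ℝ, ∀ x, f x ≤ ⟨N, 0⟩ := by
  obtain ⟨-, ⟨⟨a, ha⟩, -⟩, -⟩ := hf
  -- Adding `1` absorbs a possible second coordinate `1` of the bound.
  exact ⟨a.fst + 1, fun x => (ha ⟨x, rfl⟩).trans
    ((RTilde.lt_mk_zero_iff _ _).2 (lt_add_one _)).le⟩

theorem exists_forall_le_fst {X : Type*} [TopologicalSpace X] {f : X → RTilde}
    (hf : f ∈ suZeroB X) : ∃ N : ℝ, ∀ x, N ≤ (f x).fst := by
  obtain ⟨-, ⟨-, ⟨a, ha⟩⟩, -⟩ := hf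
  refine ⟨a.fst, fun x => ?_⟩
  rcases (RTilde.le_iff _ _).1 (ha ⟨x, rfl⟩) with h | h
  · exact h.le
  · exact h.1.le

/-- Every value allowed by `f` at `P` is the value of an element allowed by `f` everywhere. -/
theorem exists_forall_le_and_valReal_eq (hf : f ∈ suZeroB (MSpec (integralClosure A L)))
    (P : MSpec (integralClosure A L)) {z : L} (hz : z ≠ 0)
    (h : f P ≤ ⟨valReal K hA P z, 0⟩) :
    ∃ x : L, x ≠ 0 ∧ (∀ Q, f Q ≤ ⟨valReal K hA Q x, 0⟩) ∧
      valReal K hA P x = valReal K hA P z := by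
  obtain ⟨N, hN⟩ := exists_forall_le_mk_zero hf
  obtain ⟨C, hC⟩ := exists_abs_valReal_le (A := A) K hA hz
  obtain ⟨Z, hZ, hzZ⟩ := exists_isCompact_valReal_eq_zero (A := A) K hA hz
  obtain ⟨hsc, -, Y, hY, hfY⟩ := hf
  -- Semicontinuity needs a strict bound, so the weak bound `(r, 0)` is read as the strict bound
  -- `(r, 1)`.
  have hW : ∀ᶠ Q in nhds P, f Q ≤ ⟨valReal K hA Q z, 0⟩ := by
    filter_upwards [hsc P _ ((RTilde.lt_mk_one_iff _ _).2 h),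
      (IsLocallyConstant.iff_eventually_eq _).1 (isLocallyConstant_valReal K hA hz) P]
      with Q h1 h2
    rw [h2]
    exact (RTilde.lt_mk_one_iff _ _).1 h1
  obtain ⟨V, hVW, hV, hPV⟩ := mem_nhds_iff.1 hW
  -- On `(Y ∪ Z) \ V` the value of `z` is at least `-C` and `f` is at most `N`, so `N + C` is what
  -- `t` must contribute. On `V` the integral factor `t` does no harm, and off `Y ∪ Z` both `f` and
  -- the value of `z` vanish.
  obtain ⟨t, htP, ht⟩ := exists_notMem_forall_le_valReal K hA ((hY.union hZ).diff hV)
    (fun h => h.2 hPV) (N + C)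
  have ht0 : t ≠ 0 := fun h => htP (h ▸ P.ideal.zero_mem)
  have htL : (t : L) ≠ 0 := by simpa using ht0
  refine ⟨z * t, mul_ne_zero hz htL, fun Q => ?_, ?_⟩
  · rw [valReal_mul K hA Q hz htL]
    have htQ := valReal_coe_nonneg K hA Q ht0
    by_cases hQV : Q ∈ V
    · exact (show f Q ≤ _ from hVW hQV).trans
        ((RTilde.mk_zero_le_mk_zero_iff _ _).2 (le_add_of_nonneg_right htQ))
    by_cases hQ : Q ∈ Y ∪ Z
    · refine (hN Q).trans ((RTilde.mk_zero_le_mk_zero_iff _ _).2 ?_)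
      have h1 := ht Q ⟨hQ, hQV⟩
      have h2 := (abs_le.1 (hC Q)).1
      linarith
    · rw [hfY Q fun h => hQ (Or.inl h), hzZ Q fun h => hQ (Or.inr h), zero_add]
      exact (RTilde.mk_zero_le_mk_zero_iff _ _).2 htQ
  · rw [valReal_mul K hA P hz htL, valReal_coe_eq_zero K hA P htP, add_zero]

/-- A power of an element of `A` whose values dominate `N` on a compact set. -/
theorem exists_algebraMap_le_valReal {Y : Set (MSpec (integralClosure A L))} (hY : IsCompact Y)
    (N : ℝ) : ∃ a : integralClosure A L, a ≠ 0 ∧ ∀ Q ∈ Y, N ≤ valReal K hA Q (a : L) := by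
  obtain ⟨a, ha, haY⟩ := exists_ne_zero_algebraMap_mem_of_isCompact hA hY
  obtain ⟨n, hn⟩ := exists_nat_ge N
  have haL : algebraMap A L a ≠ 0 := by
    rw [IsScalarTower.algebraMap_apply A K L]
    simpa using ha
  have ha0 : algebraMap A (integralClosure A L) a ≠ 0 := fun h => haL (congrArg Subtype.val h)
  refine ⟨algebraMap A _ a ^ n, pow_ne_zero n ha0, fun Q hQ => hn.trans ?_⟩
  show (n : ℝ) ≤ valReal K hA Q (algebraMap A L a ^ n)
  rw [valReal_pow K hA Q haL]
  exact le_mul_of_one_le_right (Nat.cast_nonneg n)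
    (one_le_valReal_algebraMap K hA Q ha (haY Q hQ))

theorem exists_ne_zero_forall_le (hf : f ∈ suZeroB (MSpec (integralClosure A L))) :
    ∃ x : L, x ≠ 0 ∧ ∀ Q, f Q ≤ ⟨valReal K hA Q x, 0⟩ := by
  obtain ⟨N, hN⟩ := exists_forall_le_mk_zero hf
  obtain ⟨-, -, Y, hY, hfY⟩ := hf
  obtain ⟨a, ha, haY⟩ := exists_algebraMap_le_valReal K hA hY N
  refine ⟨a, by simpa using ha, fun Q => ?_⟩
  by_cases hQ : Q ∈ Y
  · exact (hN Q).trans ((RTilde.mk_zero_le_mk_zero_iff _ _).2 (haY Q hQ))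
  · rw [hfY Q hQ]
    exact (RTilde.mk_zero_le_mk_zero_iff _ _).2 (valReal_coe_nonneg K hA Q ha)

variable (f) in
/-- The elements of `L` whose values are bounded below by `f`. -/
noncomputable def submoduleOfFun : Submodule (integralClosure A L) L where
  carrier := {x | x ≠ 0 → ∀ P, f P ≤ ⟨valReal K hA P x, 0⟩}
  zero_mem' := fun h => absurd rfl h
  add_mem' := by
    intro x y hx hy hxy P
    by_cases hx0 : x = 0
    · rw [hx0, zero_add] at hxy ⊢
      exact hy hxy P
    by_cases hy0 : y = 0
    · rw [hy0, add_zero] at hxy ⊢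
      exact hx hxy P
    rcases valReal_add K hA P hx0 hy0 hxy with h | h
    · exact (hx hx0 P).trans ((RTilde.mk_zero_le_mk_zero_iff _ _).2 h)
    · exact (hy hy0 P).trans ((RTilde.mk_zero_le_mk_zero_iff _ _).2 h)
  smul_mem' := by
    intro c x hx hcx P
    change (c : L) * x ≠ 0 at hcx
    have hc0 : (c : L) ≠ 0 := left_ne_zero_of_mul hcx
    have hx0 := right_ne_zero_of_mul hcx
    refine (hx hx0 P).trans ((RTilde.mk_zero_le_mk_zero_iff _ _).2 ?_)
    show valReal K hA P x ≤ valReal K hA P ((c : L) * x)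
    rw [valReal_mul K hA P hc0 hx0]
    exact le_add_of_nonneg_left (valReal_coe_nonneg K hA P (by simpa using hc0))

/-- An integral `a` with values at least `-N` on the support, where `N` is a lower bound of `f`,
makes `a * x` integral at every maximal ideal, hence integral. -/
theorem isFractional_submoduleOfFun (hf : f ∈ suZeroB (MSpec (integralClosure A L))) :
    IsFractional (nonZeroDivisors (integralClosure A L)) (submoduleOfFun K hA f) := by
  obtain ⟨N, hN⟩ := exists_forall_le_fst hf
  obtain ⟨-, -, Y, hY, hfY⟩ := hf
  obtain ⟨a, ha, haY⟩ := exists_algebraMap_le_valReal K hA hY (-N)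
  have haL : (a : L) ≠ 0 := by simpa using ha
  refine ⟨a, mem_nonZeroDivisors_of_ne_zero ha, fun x hx => ?_⟩
  suffices h : (a : L) * x ∈ integralClosure A L from ⟨⟨_, h⟩, rfl⟩
  by_cases hx0 : x = 0
  · rw [hx0, mul_zero]
    exact zero_mem _
  refine mem_integralClosure_of_valReal_nonneg K hA (mul_ne_zero haL hx0) fun Q => ?_
  rw [valReal_mul K hA Q haL hx0]
  have hxQ := hx hx0 Q
  by_cases hQ : Q ∈ Y
  · have h1 : (f Q).fst ≤ valReal K hA Q x := by
      rcases (RTilde.le_iff _ _).1 hxQ with h | h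
      · exact h.le
      · exact h.1.le
    have h2 := haY Q hQ
    have h3 := hN Q
    linarith
  · rw [hfY Q hQ] at hxQ
    exact add_nonneg (valReal_coe_nonneg K hA Q ha) ((RTilde.mk_zero_le_mk_zero_iff _ _).1 hxQ)

/-- The values of `I` at `P` are exactly the `r` in the value group with `f P ≤ (r, 0)`. Membership
in `valTilde` ensures that the cut of this set is `f P`: either the minimum is itself a value, or
density supplies values just above `(f P).fst`. -/
theorem exists_idealFun_eq (hf : f ∈ suZeroBTilde (A := A) (L := L) K hA) :
    ∃ I : FractionalIdeal (nonZeroDivisors (integralClosure A L)) L, I ≠ 0 ∧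
      idealFun K hA I = f := by
  obtain ⟨hfb, hfv⟩ := hf
  let I : FractionalIdeal (nonZeroDivisors (integralClosure A L)) L :=
    ⟨submoduleOfFun K hA f, isFractional_submoduleOfFun K hA hfb⟩
  have hI : ∀ x, x ∈ I ↔ (x ≠ 0 → ∀ P, f P ≤ ⟨valReal K hA P x, 0⟩) := fun x => Iff.rfl
  refine ⟨I, fun h0 => ?_, funext fun P => ?_⟩
  · obtain ⟨x, hx0, hx⟩ := exists_ne_zero_forall_le K hA hfb
    have hxI : x ∈ I := (hI x).2 fun _ => hx
    rw [h0] at hxI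
    exact hx0 ((FractionalIdeal.mem_zero_iff _).1 hxI)
  · have hval : ∀ r, r ∈ valuesOn K hA P {x | x ∈ I} ↔
        r ∈ valueGroup K hA P ∧ f P ≤ ⟨r, 0⟩ := by
      intro r
      constructor
      · intro hr
        refine ⟨valuesOn_subset_valueGroup K hA P _ hr, ?_⟩
        obtain ⟨x, hx, hx0, rfl⟩ := (mem_valuesOn_iff K hA P _ _).1 hr
        exact (hI x).1 hx hx0 P
      · rintro ⟨hr, h⟩
        obtain ⟨z, -, hz0, rfl⟩ := (mem_valuesOn_iff K hA P _ _).1 hr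
        obtain ⟨x, hx0, hx, hxz⟩ := exists_forall_le_and_valReal_eq K hA hfb P hz0 h
        exact (mem_valuesOn_iff K hA P _ _).2 ⟨x, (hI x).2 fun _ => hx, hx0, hxz⟩
    rw [idealFun_eq_cut]
    rcases hfv P trivial with ⟨hG, h0⟩ | ⟨hdense, h1⟩
    · refine RTilde.cut_eq_of_snd_eq_zero h0 ((hval _).2 ⟨hG, ?_⟩) fun s hs => ?_
      · exact (RTilde.le_mk_zero_of_snd_eq_zero h0 _).2 le_rfl
      · exact (RTilde.le_mk_zero_of_snd_eq_zero h0 _).1 ((hval _).1 hs).2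
    · refine RTilde.cut_eq_of_snd_eq_one h1 (fun s hs => ?_) fun r hr => ?_
      · exact (RTilde.le_mk_zero_of_snd_eq_one h1 _).1 ((hval _).1 hs).2
      · obtain ⟨s, hs, h1s, hsr⟩ := (dense_iff_closure_eq.2 hdense).exists_between hr
        exact ⟨s, (hval s).2 ⟨hs, (RTilde.le_mk_zero_of_snd_eq_one h1 _).2 h1s⟩, hsr⟩

theorem iota_mem_valMonoid {P : MSpec (integralClosure A L)} {a : RTilde}
    (ha : a ∈ valMonoid K hA P) : RTilde.iota a ∈ valMonoid K hA P :=
  ⟨(valueGroup K hA P).neg_mem ha.1, ha.2⟩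

theorem iota_mem_valTilde {P : MSpec (integralClosure A L)} {a : RTilde}
    (ha : a ∈ valTilde K hA P) : RTilde.iota a ∈ valTilde K hA P :=
  ha.imp (iota_mem_valMonoid K hA) fun h => h

end values

/-! ### Quasi-inverses and inverses in `ℝ × {0, 1}` -/

namespace RTilde

theorem add_iota_add (a : RTilde) : a + iota a + a = a :=
  RTilde.ext (by simp [iota_fst]) (by simp [iota_snd])

/-- The element `b` may have a smaller second coordinate than `a`, so it need not be `ι a`; the sum
`b + a + b` corrects this. Applied pointwise, it expresses `ι ∘ f` as a sum of functions already
known to be semicontinuous. -/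
theorem iota_eq_of_eq_add {a b : RTilde} (h : a = a + b + a) : iota a = b + a + b := by
  have h1 := congrArg fst h
  have h2 := congrArg snd h
  simp only [add_fst, add_snd] at h1 h2
  have hle : b.snd ≤ a.snd := by
    rw [h2]
    exact (le_max_right _ _).trans (le_max_left _ _)
  refine RTilde.ext ?_ ?_
  · rw [iota_fst, add_fst, add_fst]
    linarith
  · rw [iota_snd, add_snd, add_snd, max_eq_right hle, max_eq_left hle]

theorem add_iota_of_snd_eq_zero {a : RTilde} (ha : a.snd = 0) : a + iota a = 0 :=
  RTilde.ext (by simp [iota_fst]) (by simp [iota_snd, ha])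

theorem snd_eq_zero_of_add_eq_zero {a b : RTilde} (h : a + b = 0) : a.snd = 0 := by
  have h2 : max a.snd b.snd = 0 := congrArg snd h
  exact Fin.le_zero_iff.1 (h2 ▸ le_max_left _ _)

theorem iota_eq_of_add_eq_zero {a b : RTilde} (h : a + b = 0) : iota a = b := by
  have h1 : a.fst + b.fst = 0 := congrArg fst h
  refine RTilde.ext ?_ ?_
  · rw [iota_fst]
    linarith
  · rw [iota_snd, snd_eq_zero_of_add_eq_zero h,
      snd_eq_zero_of_add_eq_zero ((add_comm b a).trans h)]

end RTilde

/-! ### The isomorphism, and regular and invertible elements -/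

section values

variable {A : Type*} (K : Type*) {L : Type*} [CommRing A] [IsDedekindDomain A]
  (hA : ¬ IsField A) [Field K] [Algebra A K] [IsFractionRing A K] [Field L] [Algebra K L]
  [Algebra A L] [IsScalarTower A K L] [Algebra.IsAlgebraic K L]

/-- The isomorphism between the monoid of fractional ideals and the monoid of functions. -/
noncomputable def idealFunEquiv :
    Additive (fracIdeals (integralClosure A L) L) ≃+ suZeroBTilde (A := A) (L := L) K hA :=
  AddEquiv.mk' (Equiv.ofBijective
    (fun I => ⟨idealFun K hA (Additive.toMul I).1, idealFun_mem_suZeroB K hA (Additive.toMul I).2,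
      fun P _ => idealFun_mem_valTilde K hA P (Additive.toMul I).2⟩)
    ⟨fun I J h => Additive.toMul.injective (Subtype.ext
      (eq_of_idealFun_eq K hA (Additive.toMul I).2 (Additive.toMul J).2 (congrArg Subtype.val h))),
    fun f => by
      obtain ⟨I, hI, h⟩ := exists_idealFun_eq K hA f.2
      exact ⟨Additive.ofMul ⟨I, hI⟩, Subtype.ext h⟩⟩)
    fun I J => Subtype.ext (funext fun P =>
      idealFun_mul K hA P (Additive.toMul I).2 (Additive.toMul J).2)

theorem coe_idealFunEquiv (I : fracIdeals (integralClosure A L) L) :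
    (idealFunEquiv (A := A) (L := L) K hA (Additive.ofMul I) : MSpec (integralClosure A L) → RTilde) =
      idealFun K hA I := rfl

/-- A reflexible `f` has the quasi-inverse `ι ∘ f`. Conversely `ι ∘ f = g + f + g` belongs to the
monoid. -/
theorem mem_suZeroRefTilde_iff (f : suZeroBTilde (A := A) (L := L) K hA) :
    (f : MSpec (integralClosure A L) → RTilde) ∈ suZeroRefTilde (A := A) (L := L) K hA ↔
      ∃ g : suZeroBTilde (A := A) (L := L) K hA, f = f + g + f := by
  constructor
  · intro hf
    refine ⟨⟨RTilde.iota ∘ f.1, hf.1.2, fun P _ => iota_mem_valTilde K hA (hf.2 P trivial)⟩, ?_⟩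
    exact Subtype.ext (funext fun P => (RTilde.add_iota_add _).symm)
  · rintro ⟨g, h⟩
    have : RTilde.iota ∘ f.1 = (g + f + g).1 := funext fun P =>
      RTilde.iota_eq_of_eq_add (congrFun (congrArg Subtype.val h) P)
    exact ⟨⟨f.2.1, this ▸ (g + f + g).2.1⟩, f.2.2⟩

/-- An inverse of `f` can only be `ι ∘ f`, and its existence forces the second coordinate of `f` to
vanish, which leaves only the values in `valMonoid`. -/
theorem mem_suZeroRefVal_iff (f : suZeroBTilde (A := A) (L := L) K hA) :
    (f : MSpec (integralClosure A L) → RTilde) ∈ suZeroRefVal (A := A) (L := L) K hA ↔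
      ∃ g : suZeroBTilde (A := A) (L := L) K hA, f + g = 0 := by
  constructor
  · intro hf
    refine ⟨⟨RTilde.iota ∘ f.1, hf.1.2,
      fun P _ => Or.inl (iota_mem_valMonoid K hA (hf.2 P trivial))⟩, ?_⟩
    exact Subtype.ext (funext fun P => RTilde.add_iota_of_snd_eq_zero (hf.2 P trivial).2)
  · rintro ⟨g, h⟩
    have h' : ∀ P, f.1 P + g.1 P = 0 := fun P => congrFun (congrArg Subtype.val h) P
    have : RTilde.iota ∘ f.1 = g.1 := funext fun P => RTilde.iota_eq_of_add_eq_zero (h' P)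
    refine ⟨⟨f.2.1, this ▸ g.2.1⟩, fun P _ => ?_⟩
    rcases f.2.2 P trivial with hP | ⟨-, hP⟩
    · exact hP
    · exact absurd ((RTilde.snd_eq_zero_of_add_eq_zero (h' P)).symm.trans hP) (by decide)

theorem coe_suZeroRefTilde_subset :
    (suZeroRefTilde (A := A) (L := L) K hA : Set (MSpec (integralClosure A L) → RTilde)) ⊆
      suZeroBTilde (A := A) (L := L) K hA :=
  fun _ hf => ⟨hf.1.1, hf.2⟩

theorem coe_suZeroRefVal_subset :
    (suZeroRefVal (A := A) (L := L) K hA : Set (MSpec (integralClosure A L) → RTilde)) ⊆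
      suZeroBTilde (A := A) (L := L) K hA :=
  fun _ hf => ⟨hf.1.1, fun P hP => Or.inl (hf.2 P hP)⟩

end values

theorem theorem2p1 {𝔬 K L : Type*} [CommRing 𝔬] [IsDedekindDomain 𝔬] (h𝔬 : ¬ IsField 𝔬)
    [Field K] [Algebra 𝔬 K] [IsFractionRing 𝔬 K] [Field L] [Algebra K L] [Algebra 𝔬 L]
    [IsScalarTower 𝔬 K L] [Algebra.IsAlgebraic K L] :
    ∃ F : Additive (fracIdeals (integralClosure 𝔬 L) L) ≃+
        suZeroBTilde (A := 𝔬) (L := L) K h𝔬,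
      (∀ I : fracIdeals (integralClosure 𝔬 L) L,
        (F (Additive.ofMul I) : MSpec (integralClosure 𝔬 L) → RTilde) = idealFun K h𝔬 I) ∧
      (fun I : fracIdeals (integralClosure 𝔬 L) L =>
          (F (Additive.ofMul I) : MSpec (integralClosure 𝔬 L) → RTilde)) ''
          {I | ∃ J : fracIdeals (integralClosure 𝔬 L) L, I = I * J * I} =
        (suZeroRefTilde (A := 𝔬) (L := L) K h𝔬 : Set (MSpec (integralClosure 𝔬 L) → RTilde)) ∧
      (fun I : fracIdeals (integralClosure 𝔬 L) L =>
          (F (Additive.ofMul I) : MSpec (integralClosure 𝔬 L) → RTilde)) ''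
          {I | ∃ J : fracIdeals (integralClosure 𝔬 L) L, I * J = 1} =
        (suZeroRefVal (A := 𝔬) (L := L) K h𝔬 : Set (MSpec (integralClosure 𝔬 L) → RTilde)) := by

  -- Regularity and invertibility are now conditions within the two monoids, so they are transported
  -- along `F`.
  let F := idealFunEquiv (A := 𝔬) (L := L) K h𝔬
  refine ⟨F, coe_idealFunEquiv K h𝔬, ?_, ?_⟩
  · ext f
    constructor
    · rintro ⟨I, ⟨J, hJ⟩, rfl⟩
      refine (mem_suZeroRefTilde_iff K h𝔬 _).2 ⟨F (Additive.ofMul J), ?_⟩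
      rw [← map_add, ← map_add, ← ofMul_mul, ← ofMul_mul, ← hJ]
    · intro hf
      obtain ⟨I, hI⟩ := F.surjective ⟨f, coe_suZeroRefTilde_subset K h𝔬 hf⟩
      obtain ⟨g, hg⟩ := (mem_suZeroRefTilde_iff K h𝔬 ⟨f, coe_suZeroRefTilde_subset K h𝔬 hf⟩).1 hf
      obtain ⟨J, rfl⟩ := F.surjective g
      rw [← hI, ← map_add, ← map_add] at hg
      exact ⟨Additive.toMul I, ⟨Additive.toMul J, F.injective hg⟩, congrArg Subtype.val hI⟩
  · ext f
    constructor
    · rintro ⟨I, ⟨J, hJ⟩, rfl⟩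
      refine (mem_suZeroRefVal_iff K h𝔬 _).2 ⟨F (Additive.ofMul J), ?_⟩
      rw [← map_add, ← ofMul_mul, hJ, ofMul_one, map_zero]
    · intro hf
      obtain ⟨I, hI⟩ := F.surjective ⟨f, coe_suZeroRefVal_subset K h𝔬 hf⟩
      obtain ⟨g, hg⟩ := (mem_suZeroRefVal_iff K h𝔬 ⟨f, coe_suZeroRefVal_subset K h𝔬 hf⟩).1 hf
      obtain ⟨J, rfl⟩ := F.surjective g
      rw [← hI, ← map_add, ← map_zero F] at hg
      exact ⟨Additive.toMul I, ⟨Additive.toMul J, F.injective hg⟩, congrArg Subtype.val hI⟩
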